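/- \textbf{Setting.} Let $\mathfrak m=\mathbb R^{1,3}$ with metric $\eta=\mathrm{diag}(1,-1,-1,-1)$, $\mathfrak l=\mathfrak{so}(1,3)$ and $\mathfrak p=\mathfrak l\ltimes\mathfrak m$ the Poincaré Lie algebra. Fix a basis $(u_A)$ of $\mathfrak p$ consisting of the standard basis $(u_b)$ of $\mathfrak m$ and a basis $(u_i)$ of $\mathfrak l$, let $\rho_i=(\rho^b_{i,d})$ be the matrix of $u_i$, and fix a nonzero volume element $\mathrm{vol}\in\Lambda^{10}\mathfrak p^*$. Put $e^{(8)}_{BC}:=\mathrm{vol}(u_B,u_C,\cdot,\dots,\cdot)\in\Lambda^8\mathfrak p^*$. A pair of indices $(B,C)$ is called \emph{admissible} if $u_B,u_C$ are not both in $\mathfrak m$. Let $\mathcal P$ be a smooth $10$-manifold (Hausdorff, second countable) and $$Q=\mathrm{Iso}(T\mathcal P,\mathfrak p)\times_{\mathcal P}\bigl((\mathfrak m\wedge\mathfrak l\oplus\Lambda^2\mathfrak l)\otimes\mathfrak p^*\bigr),$$ with multiplier coordinates $p_A^{BC}=-p_A^{CB}$, $(B,C)$ admissible; complete them by the fixed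 components $p_A^{bc}=2\delta_A^i\rho^b_{i,d}\eta^{dc}$ for $b,c$ indices of $\mathfrak m$. Let $\lambda$ be the canonical $\mathfrak p$-valued $1$-form on $Q$, $\Lambda=d\lambda+\tfrac12[\lambda\wedge\lambda]$ (so $\tfrac12[\lambda\wedge\lambda](X,Y)=[\lambda(X),\lambda(Y)]$), $\lambda^{(8)}_{BC}=\lambda^*e^{(8)}_{BC}$, and let $$\Theta=\tfrac12\,p_A^{BC}\,\Lambda^A\wedge\lambda^{(8)}_{BC},\qquad \mathrm{EL}_X=X\lrcorner\, d\Theta$$ be the Poincaré–Cartan form and the Euler–Lagrange form of a vector field $X$ on $Q$ that is vertical over $\mathcal P$. A variation of the multiplier is a smooth vector field on $Q$ tangent to the multiplier fibres (so that the coframe is unchanged); $\partial/\partial p_A^{BC}$ denotes the one with $dp_D^{EF}(\partial/\partial p_A^{BC})=\tfrac12\delta^A_D(\delta^E_B\delta^F_C-\delta^E_C\delta^F_B)$. A field is a smooth section $(\varpi,P)$ of $Q$: a smooth $\mathfrak p$-valued coframe $\varpi$ and smooth multipliers $P_A^{BC}$. Write $\varpi^{(8)}_{BC}=\varpi^*e^{(8)}_{BC}$,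 $\Omega=d\varpi+\tfrac12[\varpi\wedge\varpi]$, $\Omega^A=\tfrac12\Omega^A_{BC}\,\varpi^B\wedge\varpi^C$, and $\bar h=\varpi^{-1}(h\oplus0)$ for $h\in\mathfrak l$. The field is critical if $(\varpi,P)^*\mathrm{EL}_X=0$ for all smooth vertical $X$ on $Q$. The coframe $\varpi$ is a generalised Cartan connection if $\mathcal L_{\bar h}\varpi+\mathrm{ad}_h\varpi=0$ for all $h\in\mathfrak l$, where $\mathcal L_X=d\,i_X+i_X\,d$. \textbf{Statement.} \begin{enumerate} \item For every $A$ and every admissible $(B,C)$, $\partial/\partial p_A^{BC}$ is a variation of the multiplier and, on $Q$, $$\mathrm{EL}_{\partial/\partial p_A^{BC}}=\tfrac12\,\Lambda^A\wedge\lambda^{(8)}_{BC}.$$ \item For every field, $(\varpi,P)^*\Lambda=\Omega$, and the following are equivalent: (a) $(\varpi,P)^*\mathrm{EL}_X=0$ for all variations $X$ of the multiplier; (b) $\Omega^A_{BC}=0$ for all $A$ and all admissible $(B,C)$; (c) $\Omega^A\wedge\varpi^{(8)}_{BC}=0$ for all $A$ and all admissible $(B,C)$. \item If (a) holds, then $\varpi$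 is a generalised Cartan connection, and $h\mapsto\bar h$ is an action of the Lie algebra $\mathfrak l$ on $\mathcal P$: each $\bar h$ is a smooth vector field, $h\mapsto\bar h$ is linear and $\overline{[h,k]}=[\bar h,\bar k]$ for all $h,k\in\mathfrak l$. (Thus $\varpi$ is equivariant under this action.) \item In particular, if the field $(\varpi,P)$ is critical, then (b) and the conclusions of 3 hold. \end{enumerate} -/

import Mathlib

open scoped Manifold ContDiff Bundle

noncomputable section

/-! ### The Lorentz and Poincaré Lie algebras -/

/-- Indices of Minkowski space: one timelike and three spacelike directions. -/
abbrev MinkIdx : Type := Fin 1 ⊕ Fin 3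

/-- Minkowski space `ℝ^{1,3}`, also regarded as an abelian Lie algebra. -/
def Mink : Type := MinkIdx → ℝ

namespace Mink

instance : NormedAddCommGroup Mink := inferInstanceAs (NormedAddCommGroup (MinkIdx → ℝ))
instance : NormedSpace ℝ Mink := inferInstanceAs (NormedSpace ℝ (MinkIdx → ℝ))
instance : FiniteDimensional ℝ Mink := inferInstanceAs (FiniteDimensional ℝ (MinkIdx → ℝ))

instance : LieRing Mink where
  bracket _ _ := 0
  add_lie _ _ _ := (add_zero (0 : Mink)).symm
  lie_add _ _ _ := (add_zero (0 : Mink)).symm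
  lie_self _ := rfl
  leibniz_lie _ _ _ := (add_zero (0 : Mink)).symm

instance : LieAlgebra ℝ Mink where
  lie_smul t _ _ := (smul_zero t : t • (0 : Mink) = 0).symm

theorem lie_eq_zero (x y : Mink) : ⁅x, y⁆ = 0 := rfl

/-- The standard basis of Minkowski space. -/
def basis : Module.Basis MinkIdx ℝ Mink := Pi.basisFun ℝ MinkIdx

end Mink

/-- The Minkowski metric `η = diag(1, -1, -1, -1)`; it is its own inverse. -/
abbrev minkMetric : Matrix MinkIdx MinkIdx ℝ := LieAlgebra.Orthogonal.indefiniteDiagonal (Fin 1) (Fin 3) ℝ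

/-- The Lorentz Lie algebra `so(1,3)`, consisting of the matrices that are skew for `η`. -/
abbrev Lorentz : Type := LieAlgebra.Orthogonal.so' (Fin 1) (Fin 3) ℝ

/-- The tautological action of a Lorentz matrix on Minkowski space, as a derivation of the
abelian Lie algebra `Mink`. -/
def lorentzAct (h : Lorentz) : LieDerivation ℝ Mink Mink where
  toLinearMap := Matrix.mulVecLin (h : Matrix MinkIdx MinkIdx ℝ)
  leibniz' x y := by
    simp only [Mink.lie_eq_zero, sub_self]
    exact map_zero (Matrix.mulVecLin (h : Matrix MinkIdx MinkIdx ℝ))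

theorem lorentzAct_apply (h : Lorentz) (x : Mink) :
    lorentzAct h x = Matrix.mulVec (h : Matrix MinkIdx MinkIdx ℝ) x := rfl

/-- The standard representation of the Lorentz Lie algebra on Minkowski space. -/
def lorentzRep : Lorentz →ₗ⁅ℝ⁆ LieDerivation ℝ Mink Mink where
  toFun := lorentzAct
  map_add' h k := by
    ext x
    exact Matrix.add_mulVec (h : Matrix MinkIdx MinkIdx ℝ) (k : Matrix MinkIdx MinkIdx ℝ) x
  map_smul' t h := by
    ext x
    exact Matrix.smul_mulVec t (h : Matrix MinkIdx MinkIdx ℝ) (x : MinkIdx → ℝ)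
  map_lie' := by
    intro h k
    ext x
    have key : ∀ (A B : Matrix MinkIdx MinkIdx ℝ) (v : MinkIdx → ℝ),
        Matrix.mulVec (A * B - B * A) v
          = Matrix.mulVec A (Matrix.mulVec B v) - Matrix.mulVec B (Matrix.mulVec A v) := by
      intro A B v
      rw [Matrix.sub_mulVec, ← Matrix.mulVec_mulVec, ← Matrix.mulVec_mulVec]
    rw [LieDerivation.commutator_apply]
    exact key h k x

/-- The Poincaré Lie algebra `𝔭 = 𝔩 ⋉ 𝔪`. -/
abbrev Poincare : Type := Mink ⋊⁅lorentzRep⁆ Lorentz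

namespace Poincare

/-- The components of an element of `𝔭`: a vector and a matrix. Only used to norm `𝔭`. -/
def components : Poincare →ₗ[ℝ] (MinkIdx → ℝ) × (MinkIdx → MinkIdx → ℝ) where
  toFun x := (x.left, (x.right : Matrix MinkIdx MinkIdx ℝ))
  map_add' _ _ := rfl
  map_smul' _ _ := rfl

theorem components_injective : Function.Injective components := by
  rintro ⟨v, h⟩ ⟨w, k⟩ e
  obtain ⟨e₁, e₂⟩ := Prod.ext_iff.mp e
  exact LieAlgebra.SemiDirectSum.ext e₁ (Subtype.ext e₂)

instance : NormedAddCommGroup Poincare :=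
  NormedAddCommGroup.induced Poincare _ components components_injective

instance : NormedSpace ℝ Poincare := NormedSpace.induced ℝ Poincare _ components

instance : FiniteDimensional ℝ Poincare :=
  FiniteDimensional.of_injective components components_injective

/-- The inclusion `𝔩 → 𝔭`, `h ↦ h ⊕ 0`. -/
def ofLorentz (h : Lorentz) : Poincare := LieAlgebra.SemiDirectSum.inr lorentzRep h

/-- Indices of `𝔭`: `Sum.inl b` for `𝔪` and `Sum.inr i` for `𝔩`. -/
abbrev Idx : Type := MinkIdx ⊕ Fin 6

/-- The basis of `𝔭` given by the standard basis of `𝔪` and a basis of `𝔩`. -/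
def basis (𝔥 : Module.Basis (Fin 6) ℝ Lorentz) : Module.Basis Idx ℝ Poincare :=
  (Mink.basis.prod 𝔥).map (LieAlgebra.SemiDirectSum.toProdl (R := ℝ) lorentzRep).symm

/-- The bracket of `𝔭` as a bilinear map. -/
def lieBilin : Poincare →ₗ[ℝ] Poincare →ₗ[ℝ] Poincare :=
  LinearMap.mk₂ ℝ (fun x y => ⁅x, y⁆) add_lie smul_lie lie_add lie_smul

/-- The bracket of `𝔭` as a `𝔭`-valued alternating 2-form `(x, y) ↦ ⁅x, y⁆` on `𝔭`. -/
def bracketForm : Poincare [⋀^Fin 2]→L[ℝ] Poincare where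
  toFun v := ⁅v 0, v 1⁆
  map_update_add' v i x y := by
    fin_cases i
    · simpa [-LieAlgebra.SemiDirectSum.lie_eq_mk] using add_lie x y (v 1)
    · simpa [-LieAlgebra.SemiDirectSum.lie_eq_mk] using lie_add (v 0) x y
  map_update_smul' v i c x := by
    fin_cases i
    · simpa [-LieAlgebra.SemiDirectSum.lie_eq_mk] using smul_lie c x (v 1)
    · simpa [-LieAlgebra.SemiDirectSum.lie_eq_mk] using lie_smul c (v 0) x
  cont := by
    have h : ∀ v : Fin 2 → Poincare, ⁅v 0, v 1⁆ = lieBilin.toContinuousBilinearMap (v 0) (v 1) :=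
      fun _ => rfl
    simp only [h]
    fun_prop
  map_eq_zero_of_eq' v i j hv hij := by
    have h : v 0 = v 1 := by
      fin_cases i <;> fin_cases j <;> simp_all
    change ⁅v 0, v 1⁆ = 0
    rw [h, lie_self]

end Poincare

/-! ### Alternating forms and differential forms on manifolds -/

section Forms

variable {V : Type*} [AddCommGroup V] [Module ℝ V] [TopologicalSpace V]
  {F : Type*} [AddCommGroup F] [Module ℝ F] [TopologicalSpace F]

/-- Interior product `v ⌟ η = η(v, ·, …, ·)`. -/
def interiorProd {k : ℕ} (v : V) (η : V [⋀^Fin (k + 1)]→L[ℝ] F) : V [⋀^Fin k]→L[ℝ] F :=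
  { η.toAlternatingMap.curryLeft v with
    cont := by
      change Continuous fun w : Fin k → V => η (Matrix.vecCons v w)
      exact η.cont.comp (continuous_const.matrixVecCons continuous_id) }

/-- The wedge product of real-valued alternating forms (sum over shuffles, no prefactor). -/
def wedgeProd {k l : ℕ} (α : V [⋀^Fin k]→L[ℝ] ℝ) (β : V [⋀^Fin l]→L[ℝ] ℝ) :
    V [⋀^Fin (k + l)]→L[ℝ] ℝ :=
  { ((LinearMap.mul' ℝ ℝ).compAlternatingMap
      (α.toAlternatingMap.domCoprod β.toAlternatingMap)).domDomCongr finSumFinEquiv with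
    cont := by
      change Continuous fun v : Fin (k + l) → V => LinearMap.mul' ℝ ℝ
        ((∑ σ : Equiv.Perm.ModSumCongr (Fin k) (Fin l), AlternatingMap.domCoprod.summand
          α.toAlternatingMap β.toAlternatingMap σ) fun i => v (finSumFinEquiv i))
      simp only [_root_.sum_apply, map_sum]
      refine continuous_finsetSum _ fun σ _ => ?_
      induction σ using Quotient.inductionOn' with | _ σ
      have h : ∀ v : Fin (k + l) → V, LinearMap.mul' ℝ ℝ
          (AlternatingMap.domCoprod.summand α.toAlternatingMap β.toAlternatingMap
            (Quotient.mk'' σ) fun i => v (finSumFinEquiv i))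
          = Equiv.Perm.sign σ • (α (fun i => v (finSumFinEquiv (σ (Sum.inl i))))
              * β (fun i => v (finSumFinEquiv (σ (Sum.inr i))))) := by
        intro v
        rw [AlternatingMap.domCoprod.summand_mk'']
        simp only [_root_.smul_apply, MultilinearMap.domDomCongr_apply,
          MultilinearMap.domCoprod_apply, map_zsmul_unit, LinearMap.mul'_apply]
        rfl
      simp only [h]
      refine Continuous.const_smul (Continuous.mul ?_ ?_) _
      · exact α.cont.comp (continuous_pi fun i => continuous_apply _)
      · exact β.cont.comp (continuous_pi fun i => continuous_apply _) }

end Forms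

section Manifolds

variable {E : Type*} [NormedAddCommGroup E] [NormedSpace ℝ E] {H : Type*} [TopologicalSpace H]
  (I : ModelWithCorners ℝ E H) {M : Type*} [TopologicalSpace M] [ChartedSpace H M]
  {E' : Type*} [NormedAddCommGroup E'] [NormedSpace ℝ E'] {H' : Type*} [TopologicalSpace H']
  (I' : ModelWithCorners ℝ E' H') {M' : Type*} [TopologicalSpace M'] [ChartedSpace H' M']
  {F : Type*} [NormedAddCommGroup F] [NormedSpace ℝ F]

/-- (Not necessarily smooth) vector fields on `M`. -/
abbrev VField (M : Type*) [TopologicalSpace M] [ChartedSpace H M] : Type _ :=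
  (x : M) → TangentSpace I x

/-- (Not necessarily smooth) `F`-valued differential `k`-forms on `M`. -/
abbrev DForm (M : Type*) [TopologicalSpace M] [ChartedSpace H M] (k : ℕ)
    (F : Type*) [NormedAddCommGroup F] [NormedSpace ℝ F] : Type _ :=
  (x : M) → TangentSpace I x [⋀^Fin k]→L[ℝ] F

/-- A vector field on `M` which is smooth on the set `s`. -/
def SmoothFieldOn [IsManifold I 1 M] (X : VField I M) (s : Set M) : Prop :=
  ContMDiffOn I I.tangent ∞ (fun x => (⟨x, X x⟩ : TangentBundle I M)) s

/-- Pullback of differential forms. -/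
def formPullback {k : ℕ} (f : M → M') (η : DForm I' M' k F) : DForm I M k F :=
  fun x => (η (f x)).compContinuousLinearMap (mfderiv I I' f x)

/-- Interior product of a vector field with a differential form. -/
def formInterior {k : ℕ} (X : VField I M) (η : DForm I M (k + 1) F) : DForm I M k F :=
  fun x => interiorProd (X x) (η x)

/-- A differential form read in the chart of `M` centred at `x`. -/
def formInChart {k : ℕ} (η : DForm I M k F) (x : M) : E → E [⋀^Fin k]→L[ℝ] F :=
  fun y => (η ((extChartAt I x).symm y)).compContinuousLinearMap
    (mfderivWithin 𝓘(ℝ, E) I (extChartAt I x).symm (Set.range I) y)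

/-- The exterior derivative of a differential form on a manifold, computed at each point `x` in the
chart centred at `x`. -/
def formExtDeriv {k : ℕ} (η : DForm I M k F) : DForm I M (k + 1) F :=
  fun x => (extDerivWithin (formInChart I η x) (Set.range I)
    (extChartAt I x x)).compContinuousLinearMap (mfderiv I 𝓘(ℝ, E) (extChartAt I x) x)

/-- The Lie derivative of a differential form of positive degree,
`L_X η = d (X ⌟ η) + X ⌟ d η`. -/
def formLieDeriv {k : ℕ} (X : VField I M) (η : DForm I M (k + 1) F) : DForm I M (k + 1) F :=
  fun x => formExtDeriv I (formInterior I X η) x + formInterior I X (formExtDeriv I η) x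

end Manifolds

/-! ### The configuration bundle -/

section Configuration

/-- The model space of the 10-manifolds below. -/
abbrev E10 : Type := EuclideanSpace ℝ (Fin 10)

/-- Whether an index of `𝔭` belongs to `𝔪`. -/
def IsMinkIdx (B : Poincare.Idx) : Prop := ∃ b, B = Sum.inl b

/-- The space of multipliers `p_A^{BC}` (written `p A B C`): antisymmetric in `B, C`, with no
`𝔪 ⊗ 𝔪` component. In other words `(𝔪 ∧ 𝔩 ⊕ Λ²𝔩) ⊗ 𝔭*` in components. -/
def Multiplier : Submodule ℝ (Poincare.Idx → Poincare.Idx → Poincare.Idx → ℝ) where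
  carrier := {p | (∀ A B C, p A C B = - p A B C) ∧
    ∀ A B C, IsMinkIdx B ∧ IsMinkIdx C → p A B C = 0}
  zero_mem' := ⟨fun _ _ _ => neg_zero.symm, fun _ _ _ _ => rfl⟩
  add_mem' := by
    rintro p q ⟨hp, hp'⟩ ⟨hq, hq'⟩
    refine ⟨fun A B C => ?_, fun A B C h => ?_⟩
    · simp only [Pi.add_apply, hp A B C, hq A B C, neg_add]
    · simp only [Pi.add_apply, hp' A B C h, hq' A B C h, add_zero]
  smul_mem' := by
    rintro c p ⟨hp, hp'⟩
    refine ⟨fun A B C => ?_, fun A B C h => ?_⟩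
    · simp only [Pi.smul_apply, hp A B C, smul_neg]
    · simp only [Pi.smul_apply, hp' A B C h, smul_zero]

variable (P : Type*) [TopologicalSpace P] [ChartedSpace E10 P]

/-- The bundle `T*P ⊗ 𝔭` of `𝔭`-valued covectors. -/
abbrev CovectorBundle [IsManifold (𝓡 10) 1 P] : Type _ :=
  Bundle.TotalSpace (E10 →L[ℝ] Poincare)
    fun z : P => TangentSpace (𝓡 10) z →L[ℝ] Bundle.Trivial P Poincare z

/-- The model with corners of `T*P ⊗ 𝔭`. -/
abbrev covectorModel : ModelWithCorners ℝ (E10 × (E10 →L[ℝ] Poincare))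
    (ModelProd E10 (E10 →L[ℝ] Poincare)) :=
  (𝓡 10).prod 𝓘(ℝ, E10 →L[ℝ] Poincare)

variable [IsManifold (𝓡 10) ∞ P]

/-- The bundle `(T*P ⊗ 𝔭) ×_P ((𝔪 ∧ 𝔩 ⊕ Λ²𝔩) ⊗ 𝔭*)`, of which the configuration bundle is the open
part `nondegenerate P`. -/
abbrev ConfigBundle : Type _ := CovectorBundle P × Multiplier

/-- The model with corners of the configuration bundle. -/
abbrev configModel : ModelWithCorners ℝ ((E10 × (E10 →L[ℝ] Poincare)) × Multiplier)
    (ModelProd (ModelProd E10 (E10 →L[ℝ] Poincare)) Multiplier) :=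
  covectorModel.prod 𝓘(ℝ, Multiplier)

/-- The configuration bundle `Q = Iso(TP, 𝔭) ×_P ((𝔪 ∧ 𝔩 ⊕ Λ²𝔩) ⊗ 𝔭*)`. -/
def nondegenerate : Set (ConfigBundle P) :=
  {q | Function.Bijective fun v : TangentSpace (𝓡 10) q.1.proj => q.1.snd v}

variable {P}

/-- The projection `Q → P`. -/
def configProj (q : ConfigBundle P) : P := q.1.proj

variable (P)

/-- The value at `q` of the canonical 1-form, as a linear map `T_q Q → 𝔭`: the covector `q`
composed with the differential of the projection to `P`. -/
def canonicalMap (q : ConfigBundle P) : TangentSpace configModel q →L[ℝ] Poincare :=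
  ContinuousLinearMap.comp (M₂ := TangentSpace (𝓡 10) (configProj q)) q.1.snd
    (mfderiv configModel (𝓡 10) configProj q)

/-- The canonical `𝔭`-valued 1-form `λ` on the configuration bundle. -/
def canonicalForm : DForm configModel (ConfigBundle P) 1 Poincare :=
  fun q => ContinuousAlternatingMap.ofSubsingleton ℝ _ _ 0 (canonicalMap P q)

/-- The universal curvature `Λ = dλ + ½ [λ ∧ λ]`, where `½ [λ ∧ λ] (X, Y) = [λ X, λ Y]`. -/
def universalCurvature : DForm configModel (ConfigBundle P) 2 Poincare :=
  fun q => formExtDeriv configModel (canonicalForm P) q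
    + Poincare.bracketForm.compContinuousLinearMap (canonicalMap P q)

end Configuration

/-! ### The Poincaré–Cartan form and the Euler–Lagrange equations

`𝔥` is a basis of `𝔩` and `vol` a volume element of `𝔭`. -/

section EulerLagrange

/-- The component `Ω^A` of a `𝔭`-valued alternating form. -/
def formComponent (𝔥 : Module.Basis (Fin 6) ℝ Lorentz) (A : Poincare.Idx)
    {V : Type*} [AddCommGroup V] [Module ℝ V] [TopologicalSpace V] {k : ℕ}
    (η : V [⋀^Fin k]→L[ℝ] Poincare) : V [⋀^Fin k]→L[ℝ] ℝ :=
  (LinearMap.toContinuousLinearMap ((Poincare.basis 𝔥).coord A)).compContinuousAlternatingMap η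

/-- The 8-form `(u_B ∧ u_C) ⌟ vol = vol(u_B, u_C, ·, …, ·)` on `𝔭`, for the basis `u` of `𝔭`. -/
def dualEightForm (𝔥 : Module.Basis (Fin 6) ℝ Lorentz) (vol : Poincare [⋀^Fin 10]→L[ℝ] ℝ)
    (B C : Poincare.Idx) : Poincare [⋀^Fin 8]→L[ℝ] ℝ :=
  interiorProd (Poincare.basis 𝔥 C) (interiorProd (Poincare.basis 𝔥 B) vol)

/-- The momenta `p_A^{BC}`: the multipliers, completed by the fixed components
`p_A^{bc} = 2 δ_A^i ρ^b_{i,d} η^{dc}`, with `ρ_i` the matrix of the basis element `𝔥 i`. -/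
def momentum (𝔥 : Module.Basis (Fin 6) ℝ Lorentz) (p : Multiplier) :
    Poincare.Idx → Poincare.Idx → Poincare.Idx → ℝ
  | Sum.inr i, Sum.inl b, Sum.inl c =>
      2 * ((𝔥 i : Matrix MinkIdx MinkIdx ℝ) * minkMetric) b c
  | Sum.inl _, Sum.inl _, Sum.inl _ => 0
  | A, B, C => (p : Poincare.Idx → Poincare.Idx → Poincare.Idx → ℝ) A B C

variable (P : Type*) [TopologicalSpace P] [ChartedSpace E10 P] [IsManifold (𝓡 10) ∞ P]

/-- The 10-form `Λ^A ∧ λ^{(8)}_{BC}` on the configuration bundle. -/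
def curvatureWedgeDual (𝔥 : Module.Basis (Fin 6) ℝ Lorentz) (vol : Poincare [⋀^Fin 10]→L[ℝ] ℝ)
    (A B C : Poincare.Idx) : DForm configModel (ConfigBundle P) 10 ℝ :=
  fun q => wedgeProd (formComponent 𝔥 A (universalCurvature P q))
    ((dualEightForm 𝔥 vol B C).compContinuousLinearMap (canonicalMap P q))

/-- The Poincaré–Cartan form `½ p_A^{BC} Λ^A ∧ λ^{(8)}_{BC}`. -/
def poincareCartan (𝔥 : Module.Basis (Fin 6) ℝ Lorentz) (vol : Poincare [⋀^Fin 10]→L[ℝ] ℝ) :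
    DForm configModel (ConfigBundle P) 10 ℝ :=
  fun q => (1 / 2 : ℝ) • ∑ A, ∑ B, ∑ C, momentum 𝔥 q.2 A B C • curvatureWedgeDual P 𝔥 vol A B C q

/-- The Euler–Lagrange form `EL_X = X ⌟ dΘ` of a vector field `X`. -/
def eulerLagrange (𝔥 : Module.Basis (Fin 6) ℝ Lorentz) (vol : Poincare [⋀^Fin 10]→L[ℝ] ℝ)
    (X : VField configModel (ConfigBundle P)) : DForm configModel (ConfigBundle P) 10 ℝ :=
  formInterior configModel X (formExtDeriv configModel (poincareCartan P 𝔥 vol))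

/-- The multiplier whose only nonzero components are `p_A^{BC} = ½` and `p_A^{CB} = -½`. -/
def multiplierUnit (A B C : Poincare.Idx) (hBC : ¬ (IsMinkIdx B ∧ IsMinkIdx C)) : Multiplier :=
  ⟨fun A' B' C' => if A' = A then
      ((if B' = B ∧ C' = C then 1 else 0) - (if B' = C ∧ C' = B then 1 else 0)) / 2 else 0, by
    refine ⟨fun A' B' C' => ?_, fun A' B' C' h => ?_⟩
    · by_cases hA : A' = A
      · simp only [hA, if_true, and_comm (a := C' = B), and_comm (a := C' = C)]
        ring
      · simp only [hA, if_false, neg_zero]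
    · have h₁ : ¬ (B' = B ∧ C' = C) := by
        rintro ⟨rfl, rfl⟩
        exact hBC h
      have h₂ : ¬ (B' = C ∧ C' = B) := by
        rintro ⟨rfl, rfl⟩
        exact hBC h.symm
      simp only [h₁, h₂, if_false, sub_self, zero_div, ite_self]⟩

/-- The coordinate vector field `∂/∂p_A^{BC}` on the configuration bundle, tangent to the multiplier
fibres. As `p` is antisymmetric in `B, C`, it satisfies
`dp_D^{EF} (∂/∂p_A^{BC}) = ½ δ_D^A (δ^E_B δ^F_C - δ^E_C δ^F_B)`. -/
def multiplierField (A B C : Poincare.Idx) (hBC : ¬ (IsMinkIdx B ∧ IsMinkIdx C)) :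
    VField configModel (ConfigBundle P) :=
  fun q => mfderiv 𝓘(ℝ, Multiplier) configModel (fun p : Multiplier => ((q.1, p) : ConfigBundle P))
    q.2 (multiplierUnit A B C hBC)

/-- Variations: smooth vector fields on the configuration bundle `nondegenerate P`, vertical over
`P`. (Values outside `nondegenerate P` are irrelevant.) -/
def IsVariation (X : VField configModel (ConfigBundle P)) : Prop :=
  SmoothFieldOn configModel X (nondegenerate P) ∧
    ∀ q ∈ nondegenerate P, mfderiv configModel (𝓡 10) configProj q (X q) = 0

/-- Variations of the multiplier: the coframe is kept fixed. -/
def IsMultiplierVariation (X : VField configModel (ConfigBundle P)) : Prop :=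
  SmoothFieldOn configModel X (nondegenerate P) ∧
    ∀ q ∈ nondegenerate P,
      mfderiv configModel covectorModel (fun q : ConfigBundle P => q.1) q (X q) = 0

/-- Smooth `𝔭`-valued coframes on `P`. -/
structure Coframe where
  /-- The isomorphism `T_z P ≃ 𝔭`. -/
  toEquiv : (z : P) → TangentSpace (𝓡 10) z ≃L[ℝ] Poincare
  smooth : ContMDiff (𝓡 10) covectorModel ∞
    fun z => (⟨z, (toEquiv z : TangentSpace (𝓡 10) z →L[ℝ] Poincare)⟩ : CovectorBundle P)

variable {P}

namespace Coframe

/-- A coframe as a `𝔭`-valued 1-form. -/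
def form (ϖ : Coframe P) : DForm (𝓡 10) P 1 Poincare :=
  fun z => ContinuousAlternatingMap.ofSubsingleton ℝ _ _ 0
    (ϖ.toEquiv z : TangentSpace (𝓡 10) z →L[ℝ] Poincare)

/-- The vector field `ϖ⁻¹(ξ)`. -/
def frameField (ϖ : Coframe P) (ξ : Poincare) : VField (𝓡 10) P :=
  fun z => (ϖ.toEquiv z).symm ξ

/-- The curvature `Ω = dϖ + ½ [ϖ ∧ ϖ]`. -/
def curvature (ϖ : Coframe P) : DForm (𝓡 10) P 2 Poincare :=
  fun z => formExtDeriv (𝓡 10) ϖ.form z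
    + Poincare.bracketForm.compContinuousLinearMap
        (ϖ.toEquiv z : TangentSpace (𝓡 10) z →L[ℝ] Poincare)

/-- The component `Ω^A_{BC}` of the curvature, where `Ω^A = ½ Ω^A_{BC} ϖ^B ∧ ϖ^C`. -/
def curvatureComponent (ϖ : Coframe P) (𝔥 : Module.Basis (Fin 6) ℝ Lorentz)
    (A B C : Poincare.Idx) (z : P) : ℝ :=
  formComponent 𝔥 A (ϖ.curvature z)
    ![ϖ.frameField (Poincare.basis 𝔥 B) z, ϖ.frameField (Poincare.basis 𝔥 C) z]

/-- The 10-form `Ω^A ∧ ϖ^{(8)}_{BC}` on `P`. -/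
def wedgeDual (ϖ : Coframe P) (𝔥 : Module.Basis (Fin 6) ℝ Lorentz)
    (vol : Poincare [⋀^Fin 10]→L[ℝ] ℝ) (A B C : Poincare.Idx) : DForm (𝓡 10) P 10 ℝ :=
  fun z => wedgeProd (formComponent 𝔥 A (ϖ.curvature z))
    ((dualEightForm 𝔥 vol B C).compContinuousLinearMap
      (ϖ.toEquiv z : TangentSpace (𝓡 10) z →L[ℝ] Poincare))

/-- The section `(ϖ, p)` of the configuration bundle. -/
def toSection (ϖ : Coframe P) (p : P → Multiplier) : P → ConfigBundle P :=
  fun z => (⟨z, (ϖ.toEquiv z : TangentSpace (𝓡 10) z →L[ℝ] Poincare)⟩, p z)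

/-- The vector field `ϖ⁻¹(h ⊕ 0)` attached to an element `h` of the Lorentz algebra. -/
def lorentzField (ϖ : Coframe P) (h : Lorentz) : VField (𝓡 10) P :=
  ϖ.frameField (Poincare.ofLorentz h)

/-- Generalised Cartan connections: coframes which are equivariant,
`L_{ϖ⁻¹(h ⊕ 0)} ϖ + ad_h ϖ = 0` for all `h` in the Lorentz algebra. -/
def IsGeneralisedCartanConnection (ϖ : Coframe P) : Prop :=
  ∀ (h : Lorentz) (z : P) (v : TangentSpace (𝓡 10) z),
    formLieDeriv (𝓡 10) (ϖ.lorentzField h) ϖ.form z ![v]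
      + ⁅Poincare.ofLorentz h, (ϖ.toEquiv z v : Poincare)⁆ = 0

end Coframe

/-- Actions of the Lorentz Lie algebra on `P`: Lie algebra morphisms to smooth vector fields. -/
structure IsLorentzAction (a : Lorentz → VField (𝓡 10) P) : Prop where
  smooth : ∀ h, SmoothFieldOn (𝓡 10) (a h) Set.univ
  map_add : ∀ h k, a (h + k) = a h + a k
  map_smul : ∀ (c : ℝ) h, a (c • h) = c • a h
  map_lie : ∀ h k, a ⁅h, k⁆ = VectorField.mlieBracket (𝓡 10) (a h) (a k)

/-- The Euler–Lagrange equation `(ϖ, p)^* EL_X = 0`. -/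
def EulerLagrangeEq (𝔥 : Module.Basis (Fin 6) ℝ Lorentz) (vol : Poincare [⋀^Fin 10]→L[ℝ] ℝ)
    (ϖ : Coframe P) (p : P → Multiplier) (X : VField configModel (ConfigBundle P)) : Prop :=
  ∀ z, formPullback (𝓡 10) configModel (ϖ.toSection p) (eulerLagrange P 𝔥 vol X) z = 0

/-- `(ϖ, p)` satisfies the Euler–Lagrange equations for all variations of the multiplier. -/
def IsMultiplierCritical (𝔥 : Module.Basis (Fin 6) ℝ Lorentz)
    (vol : Poincare [⋀^Fin 10]→L[ℝ] ℝ) (ϖ : Coframe P) (p : P → Multiplier) : Prop :=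
  ∀ X, IsMultiplierVariation P X → EulerLagrangeEq 𝔥 vol ϖ p X

/-- `(ϖ, p)` is a critical field: it satisfies all Euler–Lagrange equations. -/
def IsCritical (𝔥 : Module.Basis (Fin 6) ℝ Lorentz)
    (vol : Poincare [⋀^Fin 10]→L[ℝ] ℝ) (ϖ : Coframe P) (p : P → Multiplier) : Prop :=
  ∀ X, IsVariation P X → EulerLagrangeEq 𝔥 vol ϖ p X

end EulerLagrange

end

open scoped Manifold ContDiff Bundle

noncomputable section

/-! ### Pullback, charts and the exterior derivative -/

section FormCalculus

open Filter Topology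

variable {E : Type*} [NormedAddCommGroup E] [NormedSpace ℝ E] {H : Type*} [TopologicalSpace H]
  {I : ModelWithCorners ℝ E H} {M : Type*} [TopologicalSpace M] [ChartedSpace H M]
  {E' : Type*} [NormedAddCommGroup E'] [NormedSpace ℝ E'] {H' : Type*} [TopologicalSpace H']
  {I' : ModelWithCorners ℝ E' H'} {M' : Type*} [TopologicalSpace M'] [ChartedSpace H' M']
  {F : Type*} [NormedAddCommGroup F] [NormedSpace ℝ F] {k : ℕ}

/-! The ambient bundle is a product: covectors with values in `𝔭`, times the vector space of
multipliers. The canonical form, its curvature and the 10-forms `Λ^A ∧ λ^{(8)}_{BC}` are pulled back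
from the covector factor, while the momenta are functions on the multiplier factor. So `Θ` is a
finite sum of terms `m_i(p) π^*θ_i`. If `X` is tangent to the multiplier fibre, then `X ⌟ π^*dθ_i`
and `X ⌟ π^*θ_i` vanish, hence `X ⌟ dΘ = ∑ dm_i(X) π^*θ_i`
(`interiorProd_formExtDeriv_sum_smul_formPullback_fst`). No structure equation for `dΛ` is needed.
The fixed momenta are constant, so only admissible index pairs contribute, and the coordinate fields
`∂/∂p_A^{BC}` isolate them one at a time.

A section pulls the tautological form back to the coframe, and `d` and `∧` commute with pullback, so
`Λ` becomes `Ω` and the multiplier equations become `Ω^A ∧ ϖ^{(8)}_{BC} = 0`. In top degree, `α ∧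
(vol contracted with u_B, u_C)` equals `α(u_B, u_C) vol`, because on a basis starting with `u_B,
u_C` a single shuffle survives (`wedgeProd_dualEightForm_eq_zero_iff`). This gives the equivalence
with the vanishing of the admissible components.

Any pair with an index in `𝔩` is admissible, so these components vanish exactly when `Ω(ϖ⁻¹h, ·) =
0` for all `h` in `𝔩`. Two identities valid for every coframe finish the proof: `L_{ϖ⁻¹ξ} ϖ + [ξ, ϖ]
= Ω(ϖ⁻¹ξ, ·)` by Cartan's formula, as `ϖ(ϖ⁻¹ξ)` is constant; and `ϖ[ϖ⁻¹ξ, ϖ⁻¹ζ] = [ξ, ζ] - Ω(ϖ⁻¹ξ,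
ϖ⁻¹ζ)`. -/

theorem formExtDeriv_eq_extDeriv [I.Boundaryless] (η : DForm I M k F) (x : M) :
    formExtDeriv I η x = (extDeriv (formInChart I η x) (extChartAt I x x)).compContinuousLinearMap
      (mfderiv I 𝓘(ℝ, E) (extChartAt I x) x) := by
  simp only [formExtDeriv, I.range_eq_univ, extDerivWithin_univ]

theorem formInChart_eq_formPullback [I.Boundaryless] (η : DForm I M k F) (x : M) :
    formInChart I η x = formPullback 𝓘(ℝ, E) I (extChartAt I x).symm η := by
  funext y
  simp only [formInChart, I.range_eq_univ, mfderivWithin_univ, formPullback]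
  rfl

/-- A differential form whose local expression in every chart is smooth at the centre. -/
def SmoothForm (I : ModelWithCorners ℝ E H) (η : DForm I M k F) : Prop :=
  ∀ x, ContDiffAt ℝ ∞ (formInChart I η x) (extChartAt I x x)

theorem formPullback_formPullback {E'' : Type*} [NormedAddCommGroup E''] [NormedSpace ℝ E'']
    {H'' : Type*} [TopologicalSpace H''] {I'' : ModelWithCorners ℝ E'' H''} {M'' : Type*}
    [TopologicalSpace M''] [ChartedSpace H'' M''] (f : M → M') (g : M' → M'')
    (η : DForm I'' M'' k F) {x : M} (hf : MDifferentiableAt I I' f x)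
    (hg : MDifferentiableAt I' I'' g (f x)) :
    formPullback I I' f (formPullback I' I'' g η) x = formPullback I I'' (g ∘ f) η x := by
  ext v
  simp only [formPullback, ContinuousAlternatingMap.compContinuousLinearMap_apply,
    mfderiv_comp x hg hf]
  rfl

theorem formPullback_congr {f g : M → M'} (η : DForm I' M' k F) {x : M} (h : f =ᶠ[𝓝 x] g) :
    formPullback I I' f η x = formPullback I I' g η x := by
  have h' := h.mfderiv_eq (I := I) (I' := I')
  have hx := h.self_of_nhds
  -- The two differentials end in tangent spaces at `f x` and `g x`, which are different types. The
  -- base points are generalised so that their equality can be substituted.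
  have key : ∀ (z z' : M') (A : TangentSpace I x →L[ℝ] TangentSpace I' z)
      (A' : TangentSpace I x →L[ℝ] TangentSpace I' z') (_ : z = z')
      (_ : ∀ v, (A v : E') = (A' v : E')),
      (η z).compContinuousLinearMap A = (η z').compContinuousLinearMap A' := by
    rintro z _ A A' rfl hA
    congr 1
    ext v
    exact hA v
  exact key _ _ _ _ hx fun v => congrArg (fun A : E →L[ℝ] E' => A v) h'

theorem formPullback_id (η : DForm I M k F) (x : M) : formPullback I I id η x = η x := by
  ext v
  simp only [formPullback, ContinuousAlternatingMap.compContinuousLinearMap_apply, mfderiv_id]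
  rfl

theorem mdifferentiableAt_extChartAt_symm_of_boundaryless [I.Boundaryless] [IsManifold I 1 M]
    {x : M} {y : E} (hy : y ∈ (extChartAt I x).target) :
    MDifferentiableAt 𝓘(ℝ, E) I (extChartAt I x).symm y := by
  have := mdifferentiableWithinAt_extChartAt_symm hy
  rwa [I.range_eq_univ, mdifferentiableWithinAt_univ] at this

/-- A form is recovered from its local expression. -/
theorem formPullback_extChartAt_formInChart [I.Boundaryless] [IsManifold I 1 M]
    (η : DForm I M k F) {x z : M} (hz : z ∈ (extChartAt I x).source) :
    formPullback I 𝓘(ℝ, E) (extChartAt I x) (formInChart I η x) z = η z := by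
  rw [formInChart_eq_formPullback, formPullback_formPullback, ← formPullback_id (I := I) η z]
  · refine formPullback_congr η ?_
    filter_upwards [(isOpen_extChartAt_source (I := I) x).mem_nhds hz] with w hw
    exact (extChartAt I x).left_inv hw
  · exact mdifferentiableAt_extChartAt (by rwa [extChartAt_source] at hz)
  · exact mdifferentiableAt_extChartAt_symm_of_boundaryless ((extChartAt I x).map_source hz)

/-- The local expression of a pullback is the pullback of the local expression. -/
theorem formInChart_formPullback_eventuallyEq [I.Boundaryless] [IsManifold I 1 M]
    [I'.Boundaryless] [IsManifold I' 1 M'] (f : M → M') (η : DForm I' M' k F) {x : M}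
    (hf : ContMDiffAt I I' 1 f x) :
    formInChart I (formPullback I I' f η) x =ᶠ[𝓝 (extChartAt I x x)] fun y =>
      (formInChart I' η (f x) (writtenInExtChartAt I I' x f y)).compContinuousLinearMap
        (fderiv ℝ (writtenInExtChartAt I I' x f) y) := by
  have hsymm : ContinuousAt (extChartAt I x).symm (extChartAt I x x) :=
    continuousAt_extChartAt_symm x
  have hx : (extChartAt I x).symm (extChartAt I x x) = x := extChartAt_to_inv x
  have h1 := (contMDiffAt_iff_contMDiffAt_nhds (by simp)).1 hf
  have h2 : ∀ᶠ z in 𝓝 x, f z ∈ (extChartAt I' (f x)).source :=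
    hf.continuousAt.eventually ((isOpen_extChartAt_source (f x)).mem_nhds (mem_extChartAt_source _))
  have h3 := hsymm.eventually (by rw [hx]; exact h1.and h2)
  have h4 : ∀ᶠ y in 𝓝 (extChartAt I x x), y ∈ (extChartAt I x).target :=
    extChartAt_target_mem_nhds x
  filter_upwards [h3, h4] with y ⟨hy1, hy2⟩ hy4
  have d1 := mdifferentiableAt_extChartAt_symm_of_boundaryless hy4
  have d2 : MDifferentiableAt I I' f ((extChartAt I x).symm y) := hy1.mdifferentiableAt one_ne_zero
  have d3 : MDifferentiableAt I' 𝓘(ℝ, E') (extChartAt I' (f x)) (f ((extChartAt I x).symm y)) :=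
    mdifferentiableAt_extChartAt (by rwa [extChartAt_source] at hy2)
  have d23 : MDifferentiableAt 𝓘(ℝ, E) I' (f ∘ (extChartAt I x).symm) y := d2.comp y d1
  rw [formInChart_eq_formPullback, formPullback_formPullback _ _ _ d1 d2]
  have e1 := formPullback_formPullback (I := 𝓘(ℝ, E)) (f ∘ (extChartAt I x).symm)
    (extChartAt I' (f x)) (formInChart I' η (f x)) d23 d3
  -- Near `f x` the form is the pullback of its own local expression; after this replacement only
  -- functoriality of pullback is needed.
  have e2 : formPullback 𝓘(ℝ, E) I' (f ∘ (extChartAt I x).symm) η y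
      = formPullback 𝓘(ℝ, E) I' (f ∘ (extChartAt I x).symm)
        (formPullback I' 𝓘(ℝ, E') (extChartAt I' (f x)) (formInChart I' η (f x))) y := by
    simp only [formPullback]
    congr 1
    exact (formPullback_extChartAt_formInChart η hy2).symm
  rw [e2, e1]
  simp only [formPullback, mfderiv_eq_fderiv]
  rfl

/-- The exterior derivative commutes with pullbacks. -/
theorem formExtDeriv_formPullback [I.Boundaryless] [IsManifold I 1 M]
    [I'.Boundaryless] [IsManifold I' 1 M'] (f : M → M') (η : DForm I' M' k F) {x : M}
    (hf : ContMDiffAt I I' 2 f x)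
    (hη : DifferentiableAt ℝ (formInChart I' η (f x)) (extChartAt I' (f x) (f x))) :
    formExtDeriv I (formPullback I I' f η) x = formPullback I I' f (formExtDeriv I' η) x := by
  have hF : ContDiffAt ℝ 2 (writtenInExtChartAt I I' x f) (extChartAt I x x) := by
    have := (contMDiffAt_iff.1 hf).2
    rwa [I.range_eq_univ, contDiffWithinAt_univ] at this
  have hFx : writtenInExtChartAt I I' x f (extChartAt I x x) = extChartAt I' (f x) (f x) := by
    simp only [writtenInExtChartAt, Function.comp_apply, extChartAt_to_inv]
  rw [formExtDeriv_eq_extDeriv, (formInChart_formPullback_eventuallyEq f η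
    (hf.of_le (by norm_num))).extDeriv_eq, extDeriv_pullback (r := 2) (by rwa [hFx]) hF (by simp)]
  simp only [formPullback, formExtDeriv_eq_extDeriv]
  have hd : MDifferentiableAt I I' f x := hf.mdifferentiableAt (by norm_num)
  -- Both composites are the differential at `x` of the chart at `f x` composed with `f`.
  have c1 : ((mfderiv I' 𝓘(ℝ, E') (extChartAt I' (f x)) (f x)).comp (mfderiv I I' f x) : E →L[ℝ] E')
      = (fderiv ℝ (writtenInExtChartAt I I' x f) (extChartAt I x x)).comp
        (mfderiv I 𝓘(ℝ, E) (extChartAt I x) x : E →L[ℝ] E) := by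
    rw [← mfderiv_eq_fderiv]
    have d1 : MDifferentiableAt I 𝓘(ℝ, E) (extChartAt I x) x :=
      mdifferentiableAt_extChartAt (mem_chart_source H x)
    have a1 := mfderiv_comp x (mdifferentiableAt_extChartAt (I := I') (mem_chart_source H' (f x))) hd
    have a2 := mfderiv_comp x (I' := 𝓘(ℝ, E)) (I'' := 𝓘(ℝ, E'))
      (hF.differentiableAt (by norm_num)).mdifferentiableAt d1
    have a3 : (extChartAt I' (f x)) ∘ f =ᶠ[𝓝 x] writtenInExtChartAt I I' x f ∘ extChartAt I x := by
      filter_upwards [extChartAt_source_mem_nhds (I := I) x] with z hz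
      simp only [Function.comp_apply, writtenInExtChartAt, (extChartAt I x).left_inv hz]
    exact (a1.symm.trans a3.mfderiv_eq).trans a2
  ext v
  simp only [hFx]
  refine congrArg (extDeriv (formInChart I' η (f x)) (extChartAt I' (f x) (f x)))
    (funext fun i => ?_)
  exact (congrArg (fun A : E →L[ℝ] E' => A (v i)) c1).symm

theorem formExtDeriv_modelSpace (η : DForm 𝓘(ℝ, E) E k F) (y : E) :
    formExtDeriv 𝓘(ℝ, E) η y = extDeriv (fun z => (η z : E [⋀^Fin k]→L[ℝ] F)) y := by
  have h : formInChart 𝓘(ℝ, E) η y = fun z => (η z : E [⋀^Fin k]→L[ℝ] F) := by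
    rw [formInChart_eq_formPullback]
    funext z
    exact formPullback_id η z
  rw [formExtDeriv_eq_extDeriv, h]
  have h1 : (mfderiv 𝓘(ℝ, E) 𝓘(ℝ, E) (extChartAt 𝓘(ℝ, E) y) y : E →L[ℝ] E)
      = ContinuousLinearMap.id ℝ E := by
    have h2 : (extChartAt 𝓘(ℝ, E) y : E → E) = id := by
      simp only [extChartAt_model_space_eq_id, PartialEquiv.refl_coe]
    refine mfderiv_eq_fderiv.trans ?_
    rw [h2, fderiv_id]
  ext v
  refine (congrArg (fun A : E →L[ℝ] E =>
    (extDeriv (fun z => (η z : E [⋀^Fin k]→L[ℝ] F)) y).compContinuousLinearMap A v) h1).trans ?_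
  rfl

/-- The local expression of the exterior derivative of a smooth form. -/
theorem formInChart_formExtDeriv [I.Boundaryless] [IsManifold I ∞ M] {η : DForm I M k F}
    (hη : SmoothForm I η) (x : M) {y : E} (hy : y ∈ (extChartAt I x).target) :
    formInChart I (formExtDeriv I η) x y = extDeriv (formInChart I η x) y := by
  have : IsManifold I 1 M := .of_le (n := ∞) (by simp)
  -- Away from the centre, `formExtDeriv` is computed in the chart of another point. Naturality of
  -- `d` under the inverse chart removes this dependence on the chart.
  rw [formInChart_eq_formPullback, ← formExtDeriv_formPullback, formExtDeriv_modelSpace,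
    formInChart_eq_formPullback]
  · have := (contMDiffOn_extChartAt_symm (I := I) (n := ∞) x).contMDiffAt
      ((isOpen_extChartAt_target x).mem_nhds hy)
    exact this.of_le (by norm_cast)
  · exact (hη _).differentiableAt (by simp)

theorem formInChart_formExtDeriv_eventuallyEq [I.Boundaryless] [IsManifold I ∞ M]
    {η : DForm I M k F} (hη : SmoothForm I η) (x : M) :
    formInChart I (formExtDeriv I η) x =ᶠ[𝓝 (extChartAt I x x)] extDeriv (formInChart I η x) := by
  filter_upwards [extChartAt_target_mem_nhds (I := I) x] with y hy
  exact formInChart_formExtDeriv hη x hy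

-- In a chart, `d` is the derivative followed by a fixed continuous linear alternation, and both
-- preserve smoothness.
set_option synthInstance.maxHeartbeats 200000 in
theorem SmoothForm.formExtDeriv [I.Boundaryless] [IsManifold I ∞ M]
    {η : DForm I M k F} (hη : SmoothForm I η) : SmoothForm I (formExtDeriv I η) := by
  intro x
  refine ContDiffAt.congr_of_eventuallyEq ?_ (formInChart_formExtDeriv_eventuallyEq hη x)
  have h : ContDiffAt ℝ ∞ (fderiv ℝ (formInChart I η x)) (extChartAt I x x) :=
    (hη x).fderiv_right (by simp)
  exact (ContinuousAlternatingMap.alternatizeUncurryFinCLM ℝ E F (n := k)).contDiff.contDiffAt.comp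
    _ h

end FormCalculus

/-! ### Evaluation and naturality of the wedge product -/

section WedgeProduct

variable {V : Type*} [AddCommGroup V] [Module ℝ V] [TopologicalSpace V]
  {V' : Type*} [AddCommGroup V'] [Module ℝ V'] [TopologicalSpace V'] {k l : ℕ}

theorem wedgeProd_apply_mk (α : V [⋀^Fin k]→L[ℝ] ℝ) (β : V [⋀^Fin l]→L[ℝ] ℝ)
    (σ : Equiv.Perm (Fin k ⊕ Fin l)) (w : Fin k ⊕ Fin l → V) :
    LinearMap.mul' ℝ ℝ (AlternatingMap.domCoprod.summand
      α.toAlternatingMap β.toAlternatingMap (Quotient.mk'' σ) w)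
      = Equiv.Perm.sign σ • (α (fun i => w (σ (Sum.inl i))) * β (fun i => w (σ (Sum.inr i)))) := by
  rw [AlternatingMap.domCoprod.summand_mk'']
  simp only [_root_.smul_apply, MultilinearMap.domDomCongr_apply,
    MultilinearMap.domCoprod_apply, map_zsmul_unit, LinearMap.mul'_apply]
  rfl

theorem wedgeProd_apply (α : V [⋀^Fin k]→L[ℝ] ℝ) (β : V [⋀^Fin l]→L[ℝ] ℝ) (v : Fin (k + l) → V) :
    wedgeProd α β v = ∑ σ : Equiv.Perm.ModSumCongr (Fin k) (Fin l),
      Equiv.Perm.sign σ.out • (α (fun i => v (finSumFinEquiv (σ.out (Sum.inl i))))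
        * β (fun i => v (finSumFinEquiv (σ.out (Sum.inr i))))) := by
  change LinearMap.mul' ℝ ℝ
        ((∑ σ : Equiv.Perm.ModSumCongr (Fin k) (Fin l), AlternatingMap.domCoprod.summand
          α.toAlternatingMap β.toAlternatingMap σ) fun i => v (finSumFinEquiv i)) = _
  simp only [_root_.sum_apply, map_sum]
  refine Finset.sum_congr rfl fun σ _ => ?_
  conv_lhs => rw [← Quotient.out_eq' σ]
  exact wedgeProd_apply_mk α β σ.out _

theorem wedgeProd_compContinuousLinearMap (α : V [⋀^Fin k]→L[ℝ] ℝ) (β : V [⋀^Fin l]→L[ℝ] ℝ)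
    (L : V' →L[ℝ] V) :
    (wedgeProd α β).compContinuousLinearMap L
      = wedgeProd (α.compContinuousLinearMap L) (β.compContinuousLinearMap L) := by
  ext v
  simp only [ContinuousAlternatingMap.compContinuousLinearMap_apply, wedgeProd_apply]
  rfl

end WedgeProduct

/-! ### Smoothness of forms built from smooth forms -/

section SmoothForms

variable {E : Type*} [NormedAddCommGroup E] [NormedSpace ℝ E] {H : Type*} [TopologicalSpace H]
  {I : ModelWithCorners ℝ E H} {M : Type*} [TopologicalSpace M] [ChartedSpace H M]
  {F : Type*} [NormedAddCommGroup F] [NormedSpace ℝ F]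
  {G : Type*} [NormedAddCommGroup G] [NormedSpace ℝ G] {k l : ℕ}

/-- A map into alternating forms on a finite-dimensional space is smooth if its values on all
families of vectors are. -/
theorem contDiffAt_of_forall_apply {V : Type*} [NormedAddCommGroup V] [NormedSpace ℝ V]
    [FiniteDimensional ℝ V] [FiniteDimensional ℝ F] {n : ℕ∞ω} {f : G → V [⋀^Fin k]→L[ℝ] F} {x : G}
    (h : ∀ v, ContDiffAt ℝ n (fun y => f y v) x) : ContDiffAt ℝ n f x := by
  let b := Module.finBasis ℝ V
  let ev : (V [⋀^Fin k]→L[ℝ] F) →ₗ[ℝ] ((Fin k → Fin (Module.finrank ℝ V)) → F) :=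
    { toFun := fun η j => η fun i => b (j i)
      map_add' := fun _ _ => rfl
      map_smul' := fun _ _ => rfl }
  have hev : Function.Injective ev := by
    intro η η' e
    apply ContinuousAlternatingMap.toAlternatingMap_injective
    exact b.ext_alternating fun j _ => congrFun e j
  have : FiniteDimensional ℝ (V [⋀^Fin k]→L[ℝ] F) := FiniteDimensional.of_injective ev hev
  -- A linear left inverse reconstructs the form from its finitely many values on basis families.
  obtain ⟨g, hg⟩ := ev.exists_leftInverse_of_injective (LinearMap.ker_eq_bot.2 hev)
  have e : f = fun y => g.toContinuousLinearMap (ev (f y)) := by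
    funext y
    exact (LinearMap.congr_fun hg (f y)).symm
  rw [e]
  refine (g.toContinuousLinearMap).contDiff.contDiffAt.comp x ?_
  exact contDiffAt_pi.2 fun j => h _

theorem ContDiffAt.alternating_apply {V : Type*} [NormedAddCommGroup V] [NormedSpace ℝ V]
    {n : ℕ∞ω} {f : G → V [⋀^Fin k]→L[ℝ] F} {x : G} (h : ContDiffAt ℝ n f x) (v : Fin k → V) :
    ContDiffAt ℝ n (fun y => f y v) x :=
  (ContinuousAlternatingMap.apply ℝ V F v).contDiff.contDiffAt.comp x h

theorem ContDiffAt.wedgeProd {V : Type*} [NormedAddCommGroup V] [NormedSpace ℝ V]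
    [FiniteDimensional ℝ V] {n : ℕ∞ω} {f : G → V [⋀^Fin k]→L[ℝ] ℝ} {g : G → V [⋀^Fin l]→L[ℝ] ℝ}
    {x : G} (hf : ContDiffAt ℝ n f x) (hg : ContDiffAt ℝ n g x) :
    ContDiffAt ℝ n (fun y => wedgeProd (f y) (g y)) x := by
  refine contDiffAt_of_forall_apply fun v => ?_
  simp only [wedgeProd_apply]
  refine ContDiffAt.sum fun σ _ => ?_
  simp only [Units.smul_def, zsmul_eq_mul]
  exact contDiffAt_const.mul ((hf.alternating_apply _).mul (hg.alternating_apply _))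

theorem SmoothForm.add {η η' : DForm I M k F} (h : SmoothForm I η) (h' : SmoothForm I η') :
    SmoothForm I (fun x => η x + η' x) :=
  fun x => (h x).add (h' x)

theorem SmoothForm.postcomp (L : F →L[ℝ] G) {η : DForm I M k F} (h : SmoothForm I η) :
    SmoothForm I (fun x => L.compContinuousAlternatingMap (η x)) :=
  fun x => (ContinuousLinearMap.compContinuousAlternatingMapCLM ℝ E F G
    (Fin k) L).contDiff.contDiffAt.comp _ (h x)

theorem SmoothForm.wedgeProd [FiniteDimensional ℝ E] {η : DForm I M k ℝ} {η' : DForm I M l ℝ}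
    (h : SmoothForm I η) (h' : SmoothForm I η') :
    SmoothForm I (fun x => _root_.wedgeProd (η x) (η' x)) := by
  intro x
  refine ((h x).wedgeProd (h' x)).congr_of_eventuallyEq (.of_eq ?_)
  funext y
  exact wedgeProd_compContinuousLinearMap _ _ _

/-- The 1-form with values in `F` given by a field of linear maps. -/
abbrev formOfLinearMaps (a : (x : M) → TangentSpace I x →L[ℝ] F) : DForm I M 1 F :=
  fun x => ContinuousAlternatingMap.ofSubsingleton ℝ _ _ 0 (a x)

/-- The form `β(a, …, a)` for a field of linear maps `a`. -/
theorem SmoothForm.compLinearMaps [FiniteDimensional ℝ E] [FiniteDimensional ℝ G]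
    {a : (x : M) → TangentSpace I x →L[ℝ] F} (h : SmoothForm I (formOfLinearMaps a))
    (β : F [⋀^Fin k]→L[ℝ] G) :
    SmoothForm I (fun x => β.compContinuousLinearMap (a x)) := by
  intro x
  refine contDiffAt_of_forall_apply fun v => ?_
  exact β.toContinuousMultilinearMap.contDiff.contDiffAt.comp _
    (contDiffAt_pi.2 fun i => (h x).alternating_apply fun _ => v i)

/-- Evaluating the local expression on a constant vector amounts to composing the function on `TM`
with the tangent map of the inverse chart and a constant section, all of which are smooth. -/
theorem smoothForm_formOfLinearMaps [I.Boundaryless] [IsManifold I ∞ M] [IsManifold I 1 M]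
    [FiniteDimensional ℝ E] [FiniteDimensional ℝ F] {a : (x : M) → TangentSpace I x →L[ℝ] F}
    (h : ContMDiff I.tangent 𝓘(ℝ, F) ∞ (fun v : TangentBundle I M => a v.1 v.2)) :
    SmoothForm I (formOfLinearMaps a) := by
  intro x
  refine contDiffAt_of_forall_apply fun v => ?_
  let φ := (extChartAt I x).symm
  have h1 : ContMDiffOn 𝓘(ℝ, E) I ∞ φ (extChartAt I x).target := contMDiffOn_extChartAt_symm x
  have ho := isOpen_extChartAt_target (I := I) x
  have h2 := h1.contMDiffOn_tangentMapWithin (m := ∞) (by simp) ho.uniqueMDiffOn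
  have h3 : ContMDiff 𝓘(ℝ, E) 𝓘(ℝ, E).tangent ∞
      (fun y : E => (⟨y, v 0⟩ : TangentBundle 𝓘(ℝ, E) E)) :=
    contMDiff_vectorSpace_iff_contDiff.2 contDiff_const
  have h4 := h.comp_contMDiffOn (h2.comp h3.contMDiffOn (s := (extChartAt I x).target)
    fun y hy => hy)
  have h5 := (h4.contMDiffAt (extChartAt_target_mem_nhds x)).contDiffAt
  refine h5.congr_of_eventuallyEq ?_
  filter_upwards [extChartAt_target_mem_nhds (I := I) x] with y hy
  rw [formInChart_eq_formPullback]
  simp only [Function.comp_apply, tangentMapWithin, mfderivWithin_of_isOpen ho hy]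
  rfl

end SmoothForms

/-! ### Contraction of an exterior derivative along the second factor of a product -/

section Product

open Filter Topology

variable {E : Type*} [NormedAddCommGroup E] [NormedSpace ℝ E] {H : Type*} [TopologicalSpace H]
  {J : ModelWithCorners ℝ E H} {C : Type*} [TopologicalSpace C] [ChartedSpace H C]
  {W : Type*} [NormedAddCommGroup W] [NormedSpace ℝ W] {k : ℕ}

/-- Charts of the product are products of charts, so projecting to the first factor commutes with
passing to charts. -/
theorem formInChart_formPullback_fst [J.Boundaryless] [IsManifold J 1 C] (η : DForm J C k ℝ)
    (q : C × W) {z : E × W} (hz : z ∈ (extChartAt (J.prod 𝓘(ℝ, W)) q).target) :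
    formInChart (J.prod 𝓘(ℝ, W)) (formPullback (J.prod 𝓘(ℝ, W)) J Prod.fst η) q z
      = (formInChart J η q.1 z.1).compContinuousLinearMap (ContinuousLinearMap.fst ℝ E W) := by
  have hz' : z.1 ∈ (extChartAt J q.1).target := by
    rw [extChartAt_prod] at hz
    exact hz.1
  have e1 : (extChartAt J q.1).symm ∘ (Prod.fst : E × W → E)
      = Prod.fst ∘ (extChartAt (J.prod 𝓘(ℝ, W)) q).symm := by
    funext w
    simp only [extChartAt_prod, Function.comp_apply, PartialEquiv.prod_symm, PartialEquiv.prod_coe]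
  have e2 := formPullback_formPullback (I := 𝓘(ℝ, E × W)) (I' := 𝓘(ℝ, E)) Prod.fst
    (extChartAt J q.1).symm η (differentiableAt_fst (p := z)).mdifferentiableAt
    (mdifferentiableAt_extChartAt_symm_of_boundaryless hz')
  rw [formInChart_eq_formPullback, formPullback_formPullback _ _ _
    (mdifferentiableAt_extChartAt_symm_of_boundaryless hz) mdifferentiableAt_fst, ← e1, ← e2,
    ← formInChart_eq_formPullback]
  have e3 : mfderiv 𝓘(ℝ, E × W) 𝓘(ℝ, E) Prod.fst z = ContinuousLinearMap.fst ℝ E W :=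
    mfderiv_eq_fderiv.trans fderiv_fst
  simp only [formPullback, e3]
  rfl

theorem formPullback_fst_eq [J.Boundaryless] [IsManifold J 1 C] (η : DForm J C k ℝ) (q : C × W) :
    formPullback (J.prod 𝓘(ℝ, W)) J Prod.fst η q
      = ((formInChart J η q.1 (extChartAt (J.prod 𝓘(ℝ, W)) q q).1).compContinuousLinearMap
          (ContinuousLinearMap.fst ℝ E W)).compContinuousLinearMap
        (mfderiv (J.prod 𝓘(ℝ, W)) 𝓘(ℝ, E × W) (extChartAt (J.prod 𝓘(ℝ, W)) q) q) := by
  rw [← formInChart_formPullback_fst η q (mem_extChartAt_target q)]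
  exact (formPullback_extChartAt_formInChart
    (formPullback (J.prod 𝓘(ℝ, W)) J Prod.fst η) (mem_extChartAt_source q)).symm

theorem mfderiv_extChartAt_prod_fst [IsManifold J 1 C] (q : C × W)
    (X : TangentSpace (J.prod 𝓘(ℝ, W)) q)
    (hX : mfderiv (J.prod 𝓘(ℝ, W)) J Prod.fst q X = 0) :
    (mfderiv (J.prod 𝓘(ℝ, W)) 𝓘(ℝ, E × W) (extChartAt (J.prod 𝓘(ℝ, W)) q) q X : E × W)
      = (0, mfderiv (J.prod 𝓘(ℝ, W)) 𝓘(ℝ, W) Prod.snd q X) := by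
  have d : MDifferentiableAt (J.prod 𝓘(ℝ, W)) 𝓘(ℝ, E × W) (extChartAt (J.prod 𝓘(ℝ, W)) q) q :=
    mdifferentiableAt_extChartAt (mem_chart_source _ q)
  have dC : MDifferentiableAt J 𝓘(ℝ, E) (extChartAt J q.1) q.1 :=
    mdifferentiableAt_extChartAt (mem_chart_source _ q.1)
  have a1 := mfderiv_comp_apply q (I' := 𝓘(ℝ, E × W)) (I'' := 𝓘(ℝ, E)) (g := Prod.fst)
    differentiableAt_fst.mdifferentiableAt d X
  have a2 := mfderiv_comp_apply q (I' := 𝓘(ℝ, E × W)) (I'' := 𝓘(ℝ, W)) (g := Prod.snd)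
    differentiableAt_snd.mdifferentiableAt d X
  have b1 : (Prod.fst : E × W → E) ∘ extChartAt (J.prod 𝓘(ℝ, W)) q = extChartAt J q.1 ∘ Prod.fst := by
    funext w
    simp only [extChartAt_prod, Function.comp_apply, PartialEquiv.prod_coe]
  have b2 : (Prod.snd : E × W → W) ∘ extChartAt (J.prod 𝓘(ℝ, W)) q = Prod.snd := by
    funext w
    simp only [extChartAt_prod, Function.comp_apply, PartialEquiv.prod_coe,
      extChartAt_model_space_eq_id, PartialEquiv.refl_coe, id]
  have a3 := mfderiv_comp_apply q (I' := J) (I'' := 𝓘(ℝ, E)) (f := (Prod.fst : C × W → C)) dC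
    mdifferentiableAt_fst X
  rw [b1, a3, hX, mfderiv_eq_fderiv, fderiv_fst] at a1
  rw [b2, mfderiv_eq_fderiv (f := (Prod.snd : E × W → W)), fderiv_snd] at a2
  refine Prod.ext ?_ a2.symm
  exact a1.symm.trans (map_zero (mfderiv J 𝓘(ℝ, E) (extChartAt J q.1) q.1))

/-- Contraction of `d (∑ mᵢ π^* θᵢ)` with a vector tangent to the second factor of a product, where
`mᵢ` are functions on the second factor and `π` is the projection to the first factor. -/
theorem interiorProd_formExtDeriv_sum_smul_formPullback_fst [J.Boundaryless] [IsManifold J 1 C]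
    {ι : Type*} (s : Finset ι) (m : ι → W → ℝ) (hm : ∀ i, Differentiable ℝ (m i))
    (θ : ι → DForm J C k ℝ) (hθ : ∀ i, SmoothForm J (θ i)) (q : C × W)
    (X : TangentSpace (J.prod 𝓘(ℝ, W)) q)
    (hX : mfderiv (J.prod 𝓘(ℝ, W)) J Prod.fst q X = 0) (Θ : DForm (J.prod 𝓘(ℝ, W)) (C × W) k ℝ)
    (hΘ : ∀ q, Θ q
      = ∑ i ∈ s, m i q.2 • formPullback (J.prod 𝓘(ℝ, W)) J Prod.fst (θ i) q) :
    interiorProd X (formExtDeriv (J.prod 𝓘(ℝ, W)) Θ q)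
      = ∑ i ∈ s, fderiv ℝ (m i) q.2 (mfderiv (J.prod 𝓘(ℝ, W)) 𝓘(ℝ, W) Prod.snd q X)
        • formPullback (J.prod 𝓘(ℝ, W)) J Prod.fst (θ i) q := by
  obtain rfl : Θ = fun q => ∑ i ∈ s, m i q.2 • formPullback (J.prod 𝓘(ℝ, W)) J Prod.fst (θ i) q :=
    funext hΘ
  set ξ : W := mfderiv (J.prod 𝓘(ℝ, W)) 𝓘(ℝ, W) Prod.snd q X with hξ
  set z₀ : E × W := extChartAt (J.prod 𝓘(ℝ, W)) q q with hz₀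
  have hz₁ : z₀.1 = extChartAt J q.1 q.1 := by simp only [hz₀, extChartAt_prod, PartialEquiv.prod_coe]
  have hz₂ : z₀.2 = q.2 := by
    simp only [hz₀, extChartAt_prod, PartialEquiv.prod_coe, extChartAt_model_space_eq_id,
      PartialEquiv.refl_coe, id]
  -- The local expression of `Θ`: coefficients depend on the second variable only, forms on the
  -- first only.
  let G : E × W → (E × W) [⋀^Fin k]→L[ℝ] ℝ := fun z => ∑ i ∈ s, m i z.2 •
    (formInChart J (θ i) q.1 z.1).compContinuousLinearMap (ContinuousLinearMap.fst ℝ E W)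
  have hG : formInChart (J.prod 𝓘(ℝ, W)) (fun q => ∑ i ∈ s, m i q.2 •
      formPullback (J.prod 𝓘(ℝ, W)) J Prod.fst (θ i) q) q =ᶠ[𝓝 z₀] G := by
    filter_upwards [extChartAt_target_mem_nhds (I := J.prod 𝓘(ℝ, W)) q] with z hz
    ext v
    simp only [G, ← formInChart_formPullback_fst _ q hz]
    have hz2 : ((extChartAt (J.prod 𝓘(ℝ, W)) q).symm z).2 = z.2 := by
      simp only [extChartAt_prod, PartialEquiv.prod_symm, PartialEquiv.prod_coe,
        extChartAt_model_space_eq_id, PartialEquiv.refl_coe, PartialEquiv.refl_symm, id]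
    simp only [formInChart, hz2, ContinuousAlternatingMap.sum_apply,
      ContinuousAlternatingMap.smul_apply]
    exact ContinuousAlternatingMap.sum_apply _ _
  have hd : ∀ i, DifferentiableAt ℝ (fun z : E × W => (formInChart J (θ i) q.1 z.1)) z₀ := by
    intro i
    have h1 : DifferentiableAt ℝ (formInChart J (θ i) q.1) z₀.1 := by
      rw [hz₁]
      exact (hθ i q.1).differentiableAt (by simp)
    exact h1.comp z₀ differentiableAt_fst
  have hGd : DifferentiableAt ℝ G z₀ := by
    refine DifferentiableAt.fun_sum fun i _ => ?_
    refine DifferentiableAt.smul ((hm i _).comp z₀ differentiableAt_snd) ?_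
    exact (ContinuousAlternatingMap.compContinuousLinearMapCLM
      (ContinuousLinearMap.fst ℝ E W)).differentiableAt.comp z₀ (hd i)
  ext v
  have hsum : ∀ (c : ι → ℝ), (∑ i ∈ s, c i • formPullback (J.prod 𝓘(ℝ, W)) J Prod.fst (θ i) q) v
      = ∑ i ∈ s, c i * formInChart J (θ i) q.1 z₀.1 fun j =>
        (mfderiv (J.prod 𝓘(ℝ, W)) 𝓘(ℝ, E × W) (extChartAt (J.prod 𝓘(ℝ, W)) q) q (v j) : E × W).1 := by
    intro c
    simp only [formPullback_fst_eq, ContinuousAlternatingMap.sum_apply,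
      ContinuousAlternatingMap.smul_apply, smul_eq_mul]
    rfl
  rw [hsum, formExtDeriv_eq_extDeriv, ← hz₀, hG.extDeriv_eq]
  let D : TangentSpace (J.prod 𝓘(ℝ, W)) q → E × W :=
    fun u => mfderiv (J.prod 𝓘(ℝ, W)) 𝓘(ℝ, E × W) (extChartAt (J.prod 𝓘(ℝ, W)) q) q u
  have hDX : D X = (0, ξ) := mfderiv_extChartAt_prod_fst q X hX
  have e1 : (interiorProd X ((extDeriv G z₀).compContinuousLinearMap
      (mfderiv (J.prod 𝓘(ℝ, W)) 𝓘(ℝ, E × W) (extChartAt (J.prod 𝓘(ℝ, W)) q) q))) v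
      = extDeriv G z₀ (Matrix.vecCons (0, ξ) fun j => D (v j)) := by
    rw [← hDX]
    refine congrArg (extDeriv G z₀) (funext fun j => ?_)
    refine Fin.cases rfl (fun j => rfl) j
  rw [e1, extDeriv_apply hGd, Fin.sum_univ_succ]
  -- When the omitted slot is not the first, `(0, ξ)` remains an argument, and its first component,
  -- the only one `G` sees, is zero.
  have e2 : ∀ i : Fin k, (fun z => G z (i.succ.removeNth
      (Matrix.vecCons ((0, ξ) : E × W) fun j => D (v j)))) = fun _ => (0 : ℝ) := by
    intro i
    funext z
    cases k with
    | zero => exact i.elim0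
    | succ k =>
      simp only [G, ContinuousAlternatingMap.sum_apply, ContinuousAlternatingMap.smul_apply,
        ContinuousAlternatingMap.compContinuousLinearMap_apply]
      refine Finset.sum_eq_zero fun j _ => ?_
      rw [ContinuousAlternatingMap.map_coord_zero _ (0 : Fin (k + 1)) (by
        simp [Fin.removeNth]), smul_zero]
  simp only [e2]
  have e3 : (fun z => G z ((0 : Fin (k + 1)).removeNth
      (Matrix.vecCons ((0, ξ) : E × W) fun j => D (v j))))
      = fun z => ∑ i ∈ s, m i z.2 * formInChart J (θ i) q.1 z.1 fun j => (D (v j)).1 := by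
    funext z
    simp only [G, ContinuousAlternatingMap.sum_apply, ContinuousAlternatingMap.smul_apply,
      smul_eq_mul]
    rfl
  -- In the product rule, derivatives of the forms factor through the first projection and die on
  -- `(0, ξ)`; the derivatives of the `m i` survive.
  have e4 : HasFDerivAt (fun z : E × W => ∑ i ∈ s, m i z.2 * formInChart J (θ i) q.1 z.1
      fun j => (D (v j)).1) (∑ i ∈ s, (m i z₀.2 • (fderiv ℝ (fun y => formInChart J (θ i) q.1 y
        fun j => (D (v j)).1) z₀.1).comp (ContinuousLinearMap.fst ℝ E W)
        + (formInChart J (θ i) q.1 z₀.1 fun j => (D (v j)).1) •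
        (fderiv ℝ (m i) z₀.2).comp (ContinuousLinearMap.snd ℝ E W))) z₀ := by
    refine HasFDerivAt.fun_sum fun i _ => ?_
    refine HasFDerivAt.mul ?_ ?_
    · exact (hm i z₀.2).hasFDerivAt.comp z₀ hasFDerivAt_snd
    · have h : DifferentiableAt ℝ (fun y => formInChart J (θ i) q.1 y fun j => (D (v j)).1) z₀.1 := ?_
      · exact h.hasFDerivAt.comp z₀ hasFDerivAt_fst
      rw [hz₁]
      exact ((hθ i q.1).alternating_apply _).differentiableAt (by simp)
  rw [e3, e4.fderiv]
  simp only [fderiv_fun_const, Pi.zero_apply, _root_.zero_apply, smul_zero,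
    Finset.sum_const_zero, add_zero, Fin.val_zero, pow_zero, one_smul, Matrix.cons_val_zero]
  rw [_root_.sum_apply]
  refine Finset.sum_congr rfl fun i _ => ?_
  simp only [_root_.add_apply, _root_.smul_apply,
    ContinuousLinearMap.comp_apply, ContinuousLinearMap.coe_fst', ContinuousLinearMap.coe_snd',
    map_zero, smul_eq_mul, mul_zero, zero_add, hz₂]
  exact mul_comm _ _

end Product

/-! ### Wedging a 2-form with a twice contracted volume form -/

section TopForms

variable {V : Type*} [AddCommGroup V] [Module ℝ V] [TopologicalSpace V]

theorem wedgeProd_zero {k l : ℕ} (α : V [⋀^Fin k]→L[ℝ] ℝ) :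
    wedgeProd α (0 : V [⋀^Fin l]→L[ℝ] ℝ) = 0 := by
  ext v
  simp [wedgeProd_apply]

/-- The wedge product of a 2-form `α` with the contraction of a volume form `μ` by two vectors
`w 0` and `w 1`, on the vectors `w`. -/
theorem wedgeProd_interiorProd_interiorProd_apply {l : ℕ} (α : V [⋀^Fin 2]→L[ℝ] ℝ)
    (μ : V [⋀^Fin (l + 1 + 1)]→L[ℝ] ℝ) (w : Fin 2 ⊕ Fin l → V) :
    wedgeProd α (interiorProd (w (Sum.inl 1)) (interiorProd (w (Sum.inl 0)) μ))
        (fun i => w (finSumFinEquiv.symm i))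
      = α (fun i => w (Sum.inl i)) * μ (Matrix.vecCons (w (Sum.inl 0))
          (Matrix.vecCons (w (Sum.inl 1)) fun i => w (Sum.inr i))) := by
  set β := interiorProd (w (Sum.inl 1)) (interiorProd (w (Sum.inl 0)) μ) with hβ
  change LinearMap.mul' ℝ ℝ
        ((∑ σ : Equiv.Perm.ModSumCongr (Fin 2) (Fin l), AlternatingMap.domCoprod.summand
          α.toAlternatingMap β.toAlternatingMap σ)
          fun i => w (finSumFinEquiv.symm (finSumFinEquiv i))) = _
  simp only [_root_.sum_apply, map_sum, Equiv.symm_apply_apply]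
  refine (Finset.sum_eq_single (Quotient.mk'' 1 : Equiv.Perm.ModSumCongr (Fin 2) (Fin l))
    ?_ ?_).trans ?_
  rotate_left 2
  · rw [wedgeProd_apply_mk]
    simp only [Equiv.Perm.sign_one, one_smul, Equiv.Perm.coe_one, id]
    rfl
  · intro σ _
    induction σ using Quotient.inductionOn' with | _ σ
    intro hσ
    rw [wedgeProd_apply_mk]
    suffices h : β (fun i => w (σ (Sum.inr i))) = 0 by rw [h, mul_zero, smul_zero]
    by_contra h
    apply hσ
    -- If a slot of `β` received `w (Sum.inl 0)` or `w (Sum.inl 1)`, that vector would occur twice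
    -- in `μ`. So `σ` preserves the right block, hence both blocks, and represents the trivial
    -- class.
    have hinr : ∀ i j, σ (Sum.inr i) ≠ Sum.inl j := by
      intro i j hij
      apply h
      change μ (Matrix.vecCons (w (Sum.inl 0)) (Matrix.vecCons (w (Sum.inl 1))
        fun i => w (σ (Sum.inr i)))) = 0
      fin_cases j
      · refine μ.map_eq_zero_of_eq _ (i := 0) (j := i.succ.succ) ?_ (Fin.succ_ne_zero _).symm
        simpa using congrArg w hij.symm
      · refine μ.map_eq_zero_of_eq _ (i := (0 : Fin (l + 1)).succ) (j := i.succ.succ) ?_ ?_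
        · simpa using congrArg w hij.symm
        · exact fun e => Fin.succ_ne_zero _ (Fin.succ_injective _ e).symm
    have hmaps : Set.MapsTo σ (Set.range Sum.inr) (Set.range Sum.inr) := by
      rintro _ ⟨i, rfl⟩
      rcases hs : σ (Sum.inr i) with j | j
      · exact absurd hs (hinr i j)
      · exact ⟨j, rfl⟩
    have hmem := Equiv.Perm.mem_sumCongrHom_range_of_perm_mapsTo_inl
      ((Equiv.Perm.perm_mapsTo_inl_iff_mapsTo_inr σ).2 hmaps)
    rw [Quotient.eq'', QuotientGroup.leftRel_apply, mul_one]
    exact inv_mem hmem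
  · intro h
    exact absurd (Finset.mem_univ _) h

theorem eq_zero_of_map_basis_eq_zero {n : ℕ} (u : Module.Basis (Fin n) ℝ V)
    (η : V [⋀^Fin n]→L[ℝ] ℝ) (h : η u = 0) : η = 0 :=
  ContinuousAlternatingMap.toAlternatingMap_injective
    ((AlternatingMap.map_basis_eq_zero_iff u η.toAlternatingMap).1 h)

theorem exists_equiv_apply_zero_apply_one {κ : Type*} [Fintype κ] {n : ℕ}
    (hκ : Fintype.card κ = n + 2) {b c : κ} (hbc : b ≠ c) :
    ∃ e : Fin 2 ⊕ Fin n ≃ κ, e (Sum.inl 0) = b ∧ e (Sum.inl 1) = c := by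
  classical
  let e₀ : Fin 2 ⊕ Fin n ≃ κ := Fintype.equivOfCardEq (by simp [hκ, add_comm])
  let e₁ := e₀.trans (Equiv.swap (e₀ (Sum.inl 0)) b)
  have h₁ : e₁ (Sum.inl 0) = b := by simp [e₁]
  refine ⟨e₁.trans (Equiv.swap (e₁ (Sum.inl 1)) c), ?_, by simp⟩
  rw [Equiv.trans_apply, h₁, Equiv.swap_apply_of_ne_of_ne _ hbc]
  rw [← h₁]
  exact fun h => by simpa using e₁.injective h

/-- A 10-form is determined by its value on one basis. On a basis beginning with the two frame
vectors, the wedge product is the value of `α` on them times a nonzero volume. If `B = C`, both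
sides vanish by antisymmetry. -/
theorem wedgeProd_dualEightForm_eq_zero_iff (𝔥 : Module.Basis (Fin 6) ℝ Lorentz)
    {vol : Poincare [⋀^Fin 10]→L[ℝ] ℝ} (hvol : vol ≠ 0) (ϖ : V ≃L[ℝ] Poincare)
    (α : V [⋀^Fin 2]→L[ℝ] ℝ) (B C : Poincare.Idx) :
    wedgeProd α ((dualEightForm 𝔥 vol B C).compContinuousLinearMap (ϖ : V →L[ℝ] Poincare)) = 0 ↔
      α ![ϖ.symm (Poincare.basis 𝔥 B), ϖ.symm (Poincare.basis 𝔥 C)] = 0 := by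
  by_cases hBC : B = C
  · subst hBC
    have h1 : dualEightForm 𝔥 vol B B = 0 := by
      ext v
      exact vol.map_eq_zero_of_eq _ (i := 0) (j := 1) rfl (by decide)
    have h2 : (dualEightForm 𝔥 vol B B).compContinuousLinearMap (ϖ : V →L[ℝ] Poincare) = 0 := by
      rw [h1]
      rfl
    rw [h2, wedgeProd_zero]
    exact iff_of_true rfl (α.map_eq_zero_of_eq _ (i := 0) (j := 1) rfl (by decide))
  obtain ⟨e, he₀, he₁⟩ := exists_equiv_apply_zero_apply_one (n := 8) (κ := Poincare.Idx)
    (by simp) hBC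
  let u : Module.Basis (Fin 2 ⊕ Fin 8) ℝ V :=
    ((Poincare.basis 𝔥).reindex e.symm).map ϖ.symm.toLinearEquiv
  let μ : V [⋀^Fin 10]→L[ℝ] ℝ := vol.compContinuousLinearMap (ϖ : V →L[ℝ] Poincare)
  have hu : ∀ i, u i = ϖ.symm (Poincare.basis 𝔥 (e i)) := fun i => by simp [u]
  have hu₀ : ϖ (u (Sum.inl 0)) = Poincare.basis 𝔥 B := by rw [hu, he₀, ϖ.apply_symm_apply]
  have hu₁ : ϖ (u (Sum.inl 1)) = Poincare.basis 𝔥 C := by rw [hu, he₁, ϖ.apply_symm_apply]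
  have hdual : (dualEightForm 𝔥 vol B C).compContinuousLinearMap (ϖ : V →L[ℝ] Poincare)
      = interiorProd (u (Sum.inl 1)) (interiorProd (u (Sum.inl 0)) μ) := by
    ext v
    rw [dualEightForm, ← hu₀, ← hu₁]
    refine congrArg vol (funext fun i => ?_)
    refine Fin.cases rfl (fun i => ?_) i
    refine Fin.cases rfl (fun i => rfl) i
  have hμ : μ ≠ 0 := by
    intro h
    apply hvol
    ext v
    have := congrArg (fun η : V [⋀^Fin 10]→L[ℝ] ℝ => η fun i => ϖ.symm (v i)) h
    simpa [μ, Function.comp_def] using this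
  have key := wedgeProd_interiorProd_interiorProd_apply α μ u
  rw [← hdual] at key
  generalize wedgeProd α
    ((dualEightForm 𝔥 vol B C).compContinuousLinearMap (ϖ : V →L[ℝ] Poincare)) = η at key ⊢
  let u' : Module.Basis (Fin 10) ℝ V := u.reindex finSumFinEquiv
  have hη : η = 0 ↔ η u' = 0 :=
    ⟨fun h => by rw [h]; rfl, fun h => eq_zero_of_map_basis_eq_zero u' η h⟩
  have hμu : μ u' ≠ 0 := fun h => hμ (eq_zero_of_map_basis_eq_zero u' μ h)
  have hu' : (u' : Fin 10 → V) = fun i => u (finSumFinEquiv.symm i) := by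
    funext i
    simp [u']
  have hcons : (Matrix.vecCons (u (Sum.inl 0)) (Matrix.vecCons (u (Sum.inl 1))
      fun i => u (Sum.inr i))) = (u' : Fin 10 → V) := by
    rw [hu']
    funext i
    fin_cases i <;> rfl
  rw [hcons] at key
  rw [hη, hu']
  rw [show η (fun i => u (finSumFinEquiv.symm i)) = _ from key, mul_eq_zero, or_iff_left hμu]
  have h2 : (fun i => u (Sum.inl i)) = ![ϖ.symm (Poincare.basis 𝔥 B), ϖ.symm (Poincare.basis 𝔥 C)] := by
    funext i
    fin_cases i
    · simp [hu, he₀]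
    · simp [hu, he₁]
  rw [h2]

end TopForms

/-! ### Frame fields, their Lie derivatives and their brackets -/

section CoframeGeometry

open Filter Topology

/-- The exterior derivative of a 1-form on two vector fields on which it is constant. -/
theorem extDeriv_apply_of_apply_eventuallyEq_const {E F : Type*} [NormedAddCommGroup E]
    [NormedSpace ℝ E] [NormedAddCommGroup F] [NormedSpace ℝ F] {θ : E → E [⋀^Fin 1]→L[ℝ] F}
    {V W : E → E} {x : E} (hθ : DifferentiableAt ℝ θ x) (hV : DifferentiableAt ℝ V x)
    (hW : DifferentiableAt ℝ W x) {a b : F} (ha : (fun y => θ y ![V y]) =ᶠ[𝓝 x] fun _ => a)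
    (hb : (fun y => θ y ![W y]) =ᶠ[𝓝 x] fun _ => b) :
    extDeriv θ x ![V x, W x] = - θ x ![VectorField.lieBracket ℝ V W x] := by
  have key := extDeriv_apply_vectorField (V := ![V, W]) hθ (by
      intro i
      fin_cases i
      · exact hV
      · exact hW)
  have h0 : (fun y => θ y ((0 : Fin 2).removeNth fun i => (![V, W] : Fin 2 → E → E) i y))
      = fun y => θ y ![W y] := by
    funext y
    refine congrArg (θ y) (funext fun i => ?_)
    fin_cases i
    rfl
  have h1 : (fun y => θ y ((1 : Fin 2).removeNth fun i => (![V, W] : Fin 2 → E → E) i y))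
      = fun y => θ y ![V y] := by
    funext y
    refine congrArg (θ y) (funext fun i => ?_)
    fin_cases i
    rfl
  have h2 : (fun i => (![V, W] : Fin 2 → E → E) i x) = ![V x, W x] := by
    funext i
    fin_cases i <;> rfl
  rw [h2, Fin.sum_univ_two, h0, h1, ha.fderiv_eq, hb.fderiv_eq] at key
  rw [key]
  simp

variable {P : Type*} [TopologicalSpace P] [ChartedSpace E10 P] [IsManifold (𝓡 10) ∞ P]

namespace Coframe

theorem contMDiff_apply (ϖ : Coframe P) : ContMDiff (𝓡 10).tangent 𝓘(ℝ, Poincare) ∞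
    (fun v : TangentBundle (𝓡 10) P => (ϖ.toEquiv v.1 v.2 : Poincare)) := by
  have h1 : ContMDiff (𝓡 10).tangent (𝓡 10) ∞ (fun v : TangentBundle (𝓡 10) P => v.1) :=
    Bundle.contMDiff_proj _
  have h2 := ContMDiff.clm_bundle_apply (F₁ := E10) (E₁ := fun z : P => TangentSpace (𝓡 10) z)
    (F₂ := Poincare) (E₂ := Bundle.Trivial P Poincare) (b := fun v : TangentBundle (𝓡 10) P => v.1)
    (ϕ := fun v => (ϖ.toEquiv v.1 : TangentSpace (𝓡 10) v.1 →L[ℝ] Poincare)) (v := fun v => v.2)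
    (ϖ.smooth.comp h1) contMDiff_id
  intro v
  exact (Bundle.contMDiffAt_totalSpace.1 (h2 v)).2

theorem smoothForm_form (ϖ : Coframe P) : SmoothForm (𝓡 10) ϖ.form :=
  smoothForm_formOfLinearMaps (a := fun z => (ϖ.toEquiv z : TangentSpace (𝓡 10) z →L[ℝ] Poincare))
    ϖ.contMDiff_apply

/-- In a trivialisation the coframe is a smooth family of invertible operators, and inversion of
operators is smooth at invertible ones. -/
theorem smoothFieldOn_frameField (ϖ : Coframe P) (ξ : Poincare) :
    SmoothFieldOn (𝓡 10) (ϖ.frameField ξ) Set.univ := by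
  intro z₀ _
  refine ContMDiffAt.contMDiffWithinAt ?_
  refine Bundle.contMDiffAt_totalSpace.2 ⟨contMDiffAt_id, ?_⟩
  let A : P → E10 →L[ℝ] Poincare := fun z => ContinuousLinearMap.inCoordinates E10
    (fun z : P => TangentSpace (𝓡 10) z) Poincare (Bundle.Trivial P Poincare) z₀ z z₀ z
    (ϖ.toEquiv z : TangentSpace (𝓡 10) z →L[ℝ] Poincare)
  have hA : ContMDiffAt (𝓡 10) 𝓘(ℝ, E10 →L[ℝ] Poincare) ∞ A z₀ :=
    ((contMDiffAt_hom_bundle _).1 (ϖ.smooth z₀)).2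
  let e := trivializationAt E10 (fun z : P => TangentSpace (𝓡 10) z) z₀
  have hAz : ∀ z (hz : z ∈ e.baseSet), A z
      = (((e.continuousLinearEquivAt ℝ z hz).symm.trans (ϖ.toEquiv z) : E10 ≃L[ℝ] Poincare) :
        E10 →L[ℝ] Poincare) := by
    intro z hz
    simp only [A]
    rw [ContinuousLinearMap.inCoordinates_eq hz (Set.mem_univ z)]
    rfl
  have hz₀ : z₀ ∈ e.baseSet := FiberBundle.mem_baseSet_trivializationAt' z₀
  have hinv : ContMDiffAt (𝓡 10) 𝓘(ℝ, E10) ∞ (fun z => (A z).inverse ξ) z₀ := by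
    have h1 : ContDiffAt ℝ ∞ ContinuousLinearMap.inverse (A z₀) := by
      rw [hAz z₀ hz₀]
      exact contDiffAt_map_inverse _
    have h2 : ContMDiffAt (𝓡 10) 𝓘(ℝ, Poincare →L[ℝ] E10) ∞ (fun z => (A z).inverse) z₀ :=
      h1.contMDiffAt.comp z₀ hA
    exact h2.clm_apply contMDiffAt_const
  refine hinv.congr_of_eventuallyEq ?_
  filter_upwards [e.open_baseSet.mem_nhds hz₀] with z hz
  rw [hAz z hz, ContinuousLinearMap.inverse_equiv]
  rfl

theorem formExtDeriv_form_apply (ϖ : Coframe P) (z : P) (v w : TangentSpace (𝓡 10) z) :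
    formExtDeriv (𝓡 10) ϖ.form z ![v, w]
      = ϖ.curvature z ![v, w] - ⁅(ϖ.toEquiv z v : Poincare), (ϖ.toEquiv z w : Poincare)⁆ := by
  rw [eq_sub_iff_add_eq]
  rfl

theorem toEquiv_frameField (ϖ : Coframe P) (ξ : Poincare) (z : P) :
    (ϖ.toEquiv z (ϖ.frameField ξ z) : Poincare) = ξ :=
  (ϖ.toEquiv z).apply_symm_apply ξ

theorem formExtDeriv_formInterior_frameField (ϖ : Coframe P) (ξ : Poincare) (z : P) :
    formExtDeriv (𝓡 10) (formInterior (𝓡 10) (ϖ.frameField ξ) ϖ.form) z = 0 := by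
  have h : formInChart (𝓡 10) (formInterior (𝓡 10) (ϖ.frameField ξ) ϖ.form) z
      = fun _ => ContinuousAlternatingMap.constOfIsEmpty ℝ E10 (Fin 0) ξ := by
    funext y
    refine ContinuousAlternatingMap.ext fun v => ?_
    exact ϖ.toEquiv_frameField ξ _
  rw [formExtDeriv_eq_extDeriv, h, extDeriv_constOfIsEmpty, fderiv_fun_const]
  exact ContinuousAlternatingMap.ext fun v => rfl

/-- The contraction of `ϖ` with its frame field is the constant `ξ`, so only `X ⌟ dϖ` survives in
Cartan's formula; the bracket term completes `dϖ` to the curvature. The failure of equivariance is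
thus a contraction of the curvature. -/
theorem formLieDeriv_frameField (ϖ : Coframe P) (ξ : Poincare) (z : P) (v : TangentSpace (𝓡 10) z) :
    formLieDeriv (𝓡 10) (ϖ.frameField ξ) ϖ.form z ![v] + ⁅ξ, (ϖ.toEquiv z v : Poincare)⁆
      = ϖ.curvature z ![ϖ.frameField ξ z, v] := by
  have h := ϖ.formExtDeriv_form_apply z (ϖ.frameField ξ z) v
  rw [toEquiv_frameField, eq_sub_iff_add_eq] at h
  have h' : formLieDeriv (𝓡 10) (ϖ.frameField ξ) ϖ.form z
      = formInterior (𝓡 10) (ϖ.frameField ξ) (formExtDeriv (𝓡 10) ϖ.form) z := by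
    rw [formLieDeriv, formExtDeriv_formInterior_frameField]
    exact zero_add _
  rw [← h, h']
  rfl

/-- The bracket of two frame fields, in terms of the curvature. -/
theorem toEquiv_mlieBracket_frameField (ϖ : Coframe P) (ξ ζ : Poincare) (z : P) :
    (ϖ.toEquiv z (VectorField.mlieBracket (𝓡 10) (ϖ.frameField ξ) (ϖ.frameField ζ) z) : Poincare)
      = ⁅ξ, ζ⁆ - ϖ.curvature z ![ϖ.frameField ξ z, ϖ.frameField ζ z] := by
  have h := ϖ.formExtDeriv_form_apply z (ϖ.frameField ξ z) (ϖ.frameField ζ z)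
  rw [toEquiv_frameField, toEquiv_frameField] at h
  rw [← neg_sub, ← h]
  -- What remains is that `ϖ` of the bracket is minus `dϖ` on the two fields, which is verified in
  -- the chart at `z`.
  let φ := extChartAt (𝓡 10) z
  let V : Poincare → E10 → E10 := fun ξ =>
    VectorField.mpullbackWithin 𝓘(ℝ, E10) (𝓡 10) φ.symm (ϖ.frameField ξ) (Set.range (𝓡 10))
  let θ := formInChart (𝓡 10) ϖ.form z
  let D : E10 →L[ℝ] E10 := mfderiv (𝓡 10) 𝓘(ℝ, E10) φ z
  have hV : ∀ ξ, DifferentiableAt ℝ (V ξ) (φ z) := by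
    intro ξ
    have h1 := (ϖ.smoothFieldOn_frameField ξ z (Set.mem_univ z)).mdifferentiableWithinAt
      (by simp)
    have h2 := h1.differentiableWithinAt_mpullbackWithin_vectorField
    rw [Set.preimage_univ, Set.univ_inter] at h2
    exact h2.differentiableAt (by rw [ModelWithCorners.range_eq_univ]; exact Filter.univ_mem)
  have hθV : ∀ ξ, ∀ y ∈ φ.target, θ y ![V ξ y] = ξ := by
    intro ξ y hy
    have h1 := isInvertible_mfderivWithin_extChartAt_symm (I := 𝓡 10) hy
    have h2 := h1.self_apply_inverse (ϖ.frameField ξ (φ.symm y))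
    refine Eq.trans ?_ (ϖ.toEquiv_frameField ξ (φ.symm y))
    exact congrArg (ϖ.toEquiv (φ.symm y)) h2
  have hz : φ z ∈ φ.target := mem_extChartAt_target z
  -- Vectors in the chart can be compared through `θ`, on which the frame fields take known values.
  have hinj : Function.Injective fun v : E10 => θ (φ z) ![v] := by
    intro v w hvw
    have h1 := (ϖ.toEquiv (φ.symm (φ z))).injective hvw
    have h2 := isInvertible_mfderivWithin_extChartAt_symm (I := 𝓡 10) hz
    exact h2.bijective.injective h1
  have hform : ∀ v : TangentSpace (𝓡 10) z, (ϖ.toEquiv z v : Poincare) = θ (φ z) ![D v] := by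
    intro v
    have h1 := formPullback_extChartAt_formInChart (I := 𝓡 10) ϖ.form (mem_extChartAt_source z)
    refine (congrArg (fun η : TangentSpace (𝓡 10) z [⋀^Fin 1]→L[ℝ] Poincare => η ![v])
      h1.symm).trans ?_
    change θ (φ z) (fun i => D ((![v] : Fin 1 → TangentSpace (𝓡 10) z) i)) = _
    refine congrArg (θ (φ z)) (funext fun i => ?_)
    fin_cases i
    rfl
  have hDV : ∀ ξ, D (ϖ.frameField ξ z) = V ξ (φ z) := by
    intro ξ
    apply hinj
    change θ (φ z) ![D (ϖ.frameField ξ z)] = θ (φ z) ![V ξ (φ z)]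
    rw [← hform, hθV _ _ hz, toEquiv_frameField]
  have hbr : D (VectorField.mlieBracket (𝓡 10) (ϖ.frameField ξ) (ϖ.frameField ζ) z)
      = VectorField.lieBracket ℝ (V ξ) (V ζ) (φ z) := by
    have h1 := isInvertible_mfderiv_extChartAt (I := 𝓡 10) (mem_extChartAt_source (I := 𝓡 10) z)
    have h2 := h1.self_apply_inverse (VectorField.lieBracketWithin ℝ (V ξ) (V ζ)
      ((φ.symm ⁻¹' Set.univ) ∩ Set.range (𝓡 10)) (φ z))
    have hs : (φ.symm ⁻¹' Set.univ) ∩ Set.range (𝓡 10) = Set.univ := by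
      rw [Set.preimage_univ, Set.univ_inter, ModelWithCorners.range_eq_univ]
    refine h2.trans ((congrArg (fun s => VectorField.lieBracketWithin ℝ (V ξ) (V ζ) s (φ z))
      hs).trans ?_)
    exact congrFun VectorField.lieBracketWithin_univ _
  have hd : formExtDeriv (𝓡 10) ϖ.form z ![ϖ.frameField ξ z, ϖ.frameField ζ z]
      = extDeriv θ (φ z) ![V ξ (φ z), V ζ (φ z)] := by
    rw [formExtDeriv_eq_extDeriv, ← hDV, ← hDV]
    refine congrArg (extDeriv θ (φ z)) (funext fun i => ?_)
    fin_cases i <;> rfl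
  rw [hform, hbr, hd]
  have hθ : ∀ ξ, (fun y => θ y ![V ξ y]) =ᶠ[𝓝 (φ z)] fun _ => ξ := fun ξ => by
    filter_upwards [extChartAt_target_mem_nhds (I := 𝓡 10) z] with y hy
    exact hθV ξ y hy
  rw [extDeriv_apply_of_apply_eventuallyEq_const
    ((ϖ.smoothForm_form z).differentiableAt (by simp)) (hV ξ) (hV ζ) (hθ ξ) (hθ ζ), neg_neg]

end Coframe

end CoframeGeometry

/-! ### The tautological form on the covector bundle and its pullbacks -/

section CovectorBundleForms

variable (P : Type*) [TopologicalSpace P] [ChartedSpace E10 P] [IsManifold (𝓡 10) ∞ P]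

/-- The value at `c` of the canonical 1-form of the bundle of `𝔭`-valued covectors. -/
def covectorMap (c : CovectorBundle P) : TangentSpace covectorModel c →L[ℝ] Poincare :=
  ContinuousLinearMap.comp (M₂ := TangentSpace (𝓡 10) c.proj) c.snd
    (mfderiv covectorModel (𝓡 10) (Bundle.TotalSpace.proj : CovectorBundle P → P) c)

/-- The canonical 1-form on the bundle of `𝔭`-valued covectors. -/
def covectorForm : DForm covectorModel (CovectorBundle P) 1 Poincare :=
  formOfLinearMaps (covectorMap P)

/-- The curvature of the canonical 1-form on the bundle of `𝔭`-valued covectors. -/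
def covectorCurvature : DForm covectorModel (CovectorBundle P) 2 Poincare :=
  fun c => formExtDeriv covectorModel (covectorForm P) c
    + Poincare.bracketForm.compContinuousLinearMap (covectorMap P c)

/-- The 10-form `Λ^A ∧ λ^{(8)}_{BC}` on the bundle of `𝔭`-valued covectors. -/
def covectorWedgeDual (𝔥 : Module.Basis (Fin 6) ℝ Lorentz) (vol : Poincare [⋀^Fin 10]→L[ℝ] ℝ)
    (A B C : Poincare.Idx) : DForm covectorModel (CovectorBundle P) 10 ℝ :=
  fun c => wedgeProd (formComponent 𝔥 A (covectorCurvature P c))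
    ((dualEightForm 𝔥 vol B C).compContinuousLinearMap (covectorMap P c))

variable {P}

theorem contMDiff_covectorProj : ContMDiff covectorModel (𝓡 10) ∞
    (Bundle.TotalSpace.proj : CovectorBundle P → P) :=
  Bundle.contMDiff_proj _

theorem contMDiff_covectorMap_apply : ContMDiff covectorModel.tangent 𝓘(ℝ, Poincare) ∞
    (fun v : TangentBundle covectorModel (CovectorBundle P) => covectorMap P v.1 v.2) := by
  have h1 : ContMDiff covectorModel.tangent covectorModel ∞
      (fun v : TangentBundle covectorModel (CovectorBundle P) => v.1) :=
    Bundle.contMDiff_proj _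
  have h3 := (contMDiff_covectorProj (P := P)).contMDiff_tangentMap (m := ∞) (by simp)
  have h2 := ContMDiff.clm_bundle_apply (F₁ := E10) (E₁ := fun z : P => TangentSpace (𝓡 10) z)
    (F₂ := Poincare) (E₂ := Bundle.Trivial P Poincare)
    (b := fun v : TangentBundle covectorModel (CovectorBundle P) => v.1.proj)
    (ϕ := fun v => v.1.snd) (v := fun v => mfderiv covectorModel (𝓡 10)
      (Bundle.TotalSpace.proj : CovectorBundle P → P) v.1 v.2) h1 h3
  intro v
  exact (Bundle.contMDiffAt_totalSpace.1 (h2 v)).2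

theorem smoothForm_covectorForm : SmoothForm covectorModel (covectorForm P) :=
  smoothForm_formOfLinearMaps contMDiff_covectorMap_apply

theorem smoothForm_covectorCurvature : SmoothForm covectorModel (covectorCurvature P) :=
  smoothForm_covectorForm.formExtDeriv.add
    (smoothForm_covectorForm.compLinearMaps Poincare.bracketForm)

theorem smoothForm_covectorWedgeDual (𝔥 : Module.Basis (Fin 6) ℝ Lorentz)
    (vol : Poincare [⋀^Fin 10]→L[ℝ] ℝ) (A B C : Poincare.Idx) :
    SmoothForm covectorModel (covectorWedgeDual P 𝔥 vol A B C) :=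
  (smoothForm_covectorCurvature.postcomp _).wedgeProd
    (smoothForm_covectorForm.compLinearMaps (dualEightForm 𝔥 vol B C))

section Pullback

variable {E : Type*} [NormedAddCommGroup E] [NormedSpace ℝ E] {H : Type*} [TopologicalSpace H]
  {I : ModelWithCorners ℝ E H} {M : Type*} [TopologicalSpace M] [ChartedSpace H M]

theorem formPullback_covectorForm_eq (f : M → CovectorBundle P)
    (a : (x : M) → TangentSpace I x →L[ℝ] Poincare)
    (hfa : ∀ x, (covectorMap P (f x)).comp (mfderiv I covectorModel f x) = a x) :
    formPullback I covectorModel f (covectorForm P) = formOfLinearMaps a := by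
  funext x
  simp only [formOfLinearMaps, ← hfa]
  rfl

/-- Stated for a general `f` to serve twice: for the projection from the configuration bundle, where
`a` is the canonical form, and for a section, where `a` is the coframe. -/
theorem formPullback_covectorCurvature [I.Boundaryless] [IsManifold I 1 M]
    (f : M → CovectorBundle P) (hf : ContMDiff I covectorModel ∞ f)
    (a : (x : M) → TangentSpace I x →L[ℝ] Poincare)
    (hfa : ∀ x, (covectorMap P (f x)).comp (mfderiv I covectorModel f x) = a x) (x : M) :
    formPullback I covectorModel f (covectorCurvature P) x
      = formExtDeriv I (formOfLinearMaps a) x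
        + Poincare.bracketForm.compContinuousLinearMap (a x) := by
  rw [← formPullback_covectorForm_eq f a hfa, formExtDeriv_formPullback f (covectorForm P)
    ((hf x).of_le (by norm_cast)) ((smoothForm_covectorForm _).differentiableAt (by simp)), ← hfa]
  rfl

theorem formPullback_covectorWedgeDual [I.Boundaryless] [IsManifold I 1 M]
    (𝔥 : Module.Basis (Fin 6) ℝ Lorentz) (vol : Poincare [⋀^Fin 10]→L[ℝ] ℝ) (A B C : Poincare.Idx)
    (f : M → CovectorBundle P) (hf : ContMDiff I covectorModel ∞ f)
    (a : (x : M) → TangentSpace I x →L[ℝ] Poincare)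
    (hfa : ∀ x, (covectorMap P (f x)).comp (mfderiv I covectorModel f x) = a x) (x : M) :
    formPullback I covectorModel f (covectorWedgeDual P 𝔥 vol A B C) x
      = wedgeProd (formComponent 𝔥 A (formExtDeriv I (formOfLinearMaps a) x
          + Poincare.bracketForm.compContinuousLinearMap (a x)))
        ((dualEightForm 𝔥 vol B C).compContinuousLinearMap (a x)) := by
  rw [← formPullback_covectorCurvature f hf a hfa, ← hfa]
  exact wedgeProd_compContinuousLinearMap _ _ _

end Pullback

theorem covectorMap_comp_mfderiv_fst (q : ConfigBundle P) :
    (covectorMap P q.1).comp (mfderiv configModel covectorModel Prod.fst q) = canonicalMap P q := by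
  have h := mfderiv_comp q (I := configModel) (I' := covectorModel) (I'' := 𝓡 10)
    (f := (Prod.fst : ConfigBundle P → CovectorBundle P))
    (contMDiff_covectorProj.mdifferentiable (by simp) q.1) mdifferentiableAt_fst
  ext1 v
  exact (congrArg (fun A : (E10 × (E10 →L[ℝ] Poincare)) × Multiplier →L[ℝ] E10 =>
    (q.1.snd (A v) : Poincare)) h).symm

theorem contMDiff_configBundle_fst : ContMDiff configModel covectorModel ∞
    (Prod.fst : ConfigBundle P → CovectorBundle P) := contMDiff_fst

theorem universalCurvature_eq_formPullback :
    universalCurvature P = formPullback configModel covectorModel Prod.fst (covectorCurvature P) := by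
  funext q
  exact (formPullback_covectorCurvature Prod.fst contMDiff_configBundle_fst (canonicalMap P)
    covectorMap_comp_mfderiv_fst q).symm

theorem curvatureWedgeDual_eq_formPullback (𝔥 : Module.Basis (Fin 6) ℝ Lorentz)
    (vol : Poincare [⋀^Fin 10]→L[ℝ] ℝ) (A B C : Poincare.Idx) :
    curvatureWedgeDual P 𝔥 vol A B C
      = formPullback configModel covectorModel Prod.fst (covectorWedgeDual P 𝔥 vol A B C) := by
  funext q
  exact (formPullback_covectorWedgeDual 𝔥 vol A B C Prod.fst contMDiff_configBundle_fst
    (canonicalMap P) covectorMap_comp_mfderiv_fst q).symm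

namespace Coframe

/-- A coframe as a section of the bundle of `𝔭`-valued covectors. -/
def covectorSection (ϖ : Coframe P) (z : P) : CovectorBundle P :=
  ⟨z, (ϖ.toEquiv z : TangentSpace (𝓡 10) z →L[ℝ] Poincare)⟩

theorem contMDiff_covectorSection (ϖ : Coframe P) :
    ContMDiff (𝓡 10) covectorModel ∞ ϖ.covectorSection := ϖ.smooth

/-- The reproducing property of the tautological form: a section followed by the projection is the
identity. -/
theorem covectorMap_comp_mfderiv_covectorSection (ϖ : Coframe P) (z : P) :
    (covectorMap P (ϖ.covectorSection z)).comp (mfderiv (𝓡 10) covectorModel ϖ.covectorSection z)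
      = (ϖ.toEquiv z : TangentSpace (𝓡 10) z →L[ℝ] Poincare) := by
  have h := mfderiv_comp z (I := 𝓡 10) (I' := covectorModel) (I'' := 𝓡 10) (f := ϖ.covectorSection)
    (contMDiff_covectorProj.mdifferentiable (by simp) _)
    (ϖ.contMDiff_covectorSection.mdifferentiable (by simp) z)
  have h' : mfderiv (𝓡 10) (𝓡 10) (Bundle.TotalSpace.proj ∘ ϖ.covectorSection) z
      = ContinuousLinearMap.id ℝ _ := mfderiv_id
  rw [h] at h'
  ext1 v
  exact congrArg (fun A : E10 →L[ℝ] E10 => (ϖ.toEquiv z (A v) : Poincare)) h'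

variable (ϖ : Coframe P) {p : P → Multiplier}

theorem mdifferentiableAt_toSection (hp : ContMDiff (𝓡 10) 𝓘(ℝ, Multiplier) ∞ p)
    (z : P) :
    MDifferentiableAt (𝓡 10) configModel (ϖ.toSection p) z :=
  (ContMDiff.prodMk ϖ.contMDiff_covectorSection hp).mdifferentiable (by simp) z

theorem formPullback_toSection_universalCurvature
    (hp : ContMDiff (𝓡 10) 𝓘(ℝ, Multiplier) ∞ p) :
    formPullback (𝓡 10) configModel (ϖ.toSection p) (universalCurvature P) = ϖ.curvature := by
  funext z
  rw [universalCurvature_eq_formPullback, formPullback_formPullback _ _ _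
    (ϖ.mdifferentiableAt_toSection hp z) mdifferentiableAt_fst]
  exact formPullback_covectorCurvature ϖ.covectorSection ϖ.contMDiff_covectorSection
    (fun z => (ϖ.toEquiv z : TangentSpace (𝓡 10) z →L[ℝ] Poincare))
    ϖ.covectorMap_comp_mfderiv_covectorSection z

theorem formPullback_toSection_curvatureWedgeDual
    (hp : ContMDiff (𝓡 10) 𝓘(ℝ, Multiplier) ∞ p) (𝔥 : Module.Basis (Fin 6) ℝ Lorentz)
    (vol : Poincare [⋀^Fin 10]→L[ℝ] ℝ) (A B C : Poincare.Idx) (z : P) :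
    formPullback (𝓡 10) configModel (ϖ.toSection p) (curvatureWedgeDual P 𝔥 vol A B C) z
      = ϖ.wedgeDual 𝔥 vol A B C z := by
  rw [curvatureWedgeDual_eq_formPullback, formPullback_formPullback _ _ _
    (ϖ.mdifferentiableAt_toSection hp z) mdifferentiableAt_fst]
  exact formPullback_covectorWedgeDual 𝔥 vol A B C ϖ.covectorSection ϖ.contMDiff_covectorSection
    (fun z => (ϖ.toEquiv z : TangentSpace (𝓡 10) z →L[ℝ] Poincare))
    ϖ.covectorMap_comp_mfderiv_covectorSection z

end Coframe

end CovectorBundleForms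

/-! ### Variations of the multiplier and their Euler–Lagrange forms -/

section Variations

theorem formInterior_apply {E : Type*} [NormedAddCommGroup E] [NormedSpace ℝ E] {H : Type*}
    [TopologicalSpace H] (I : ModelWithCorners ℝ E H) {M : Type*} [TopologicalSpace M]
    [ChartedSpace H M] {F : Type*} [NormedAddCommGroup F] [NormedSpace ℝ F] {k : ℕ}
    (X : VField I M) (η : DForm I M (k + 1) F) (x : M) :
    formInterior I X η x = interiorProd (X x) (η x) := rfl

/-- The component `p ↦ p_A^{BC}` of a multiplier, as a continuous linear map. -/
def multiplierComponent (A B C : Poincare.Idx) : Multiplier →L[ℝ] ℝ :=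
  LinearMap.toContinuousLinearMap
    { toFun := fun p => (p : Poincare.Idx → Poincare.Idx → Poincare.Idx → ℝ) A B C
      map_add' := fun _ _ => rfl
      map_smul' := fun _ _ => rfl }

theorem multiplierComponent_eq_zero {A B C : Poincare.Idx} (h : IsMinkIdx B ∧ IsMinkIdx C) :
    multiplierComponent A B C = 0 := by
  ext p
  exact p.2.2 A B C h

/-- The fixed `𝔪`-`𝔪` momenta are constant, and the corresponding multiplier component is
identically zero, so one formula covers all indices. -/
theorem hasFDerivAt_momentum (𝔥 : Module.Basis (Fin 6) ℝ Lorentz) (A B C : Poincare.Idx)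
    (p : Multiplier) :
    HasFDerivAt (fun p => momentum 𝔥 p A B C) (multiplierComponent A B C) p := by
  have hlin : HasFDerivAt (fun p : Multiplier =>
      (p : Poincare.Idx → Poincare.Idx → Poincare.Idx → ℝ) A B C) (multiplierComponent A B C) p :=
    (multiplierComponent A B C).hasFDerivAt
  rcases B with b | j
  · rcases C with c | k
    · rw [multiplierComponent_eq_zero ⟨⟨b, rfl⟩, ⟨c, rfl⟩⟩]
      rcases A with a | i <;> exact hasFDerivAt_const _ _
    · rcases A with a | i <;> exact hlin
  · rcases A with a | i <;> exact hlin

variable {P : Type*} [TopologicalSpace P] [ChartedSpace E10 P] [IsManifold (𝓡 10) ∞ P]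

/-- The Euler–Lagrange form at a point at which the vector field is tangent to the multiplier
fibre. -/
theorem eulerLagrange_eq_sum (𝔥 : Module.Basis (Fin 6) ℝ Lorentz)
    (vol : Poincare [⋀^Fin 10]→L[ℝ] ℝ) (X : VField configModel (ConfigBundle P))
    (q : ConfigBundle P) (hX : mfderiv configModel covectorModel Prod.fst q (X q) = 0) :
    eulerLagrange P 𝔥 vol X q = ∑ i : Poincare.Idx × Poincare.Idx × Poincare.Idx,
      ((1 / 2 : ℝ) * multiplierComponent i.1 i.2.1 i.2.2
        (mfderiv configModel 𝓘(ℝ, Multiplier) Prod.snd q (X q)))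
        • curvatureWedgeDual P 𝔥 vol i.1 i.2.1 i.2.2 q := by
  let m : Poincare.Idx × Poincare.Idx × Poincare.Idx → Multiplier → ℝ :=
    fun i p => (1 / 2 : ℝ) * momentum 𝔥 p i.1 i.2.1 i.2.2
  have hm : ∀ i p, HasFDerivAt (m i) ((1 / 2 : ℝ) • multiplierComponent i.1 i.2.1 i.2.2) p :=
    fun i p => (hasFDerivAt_momentum 𝔥 i.1 i.2.1 i.2.2 p).const_mul _
  have key := interiorProd_formExtDeriv_sum_smul_formPullback_fst Finset.univ m
    (fun i p => (hm i p).differentiableAt)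
    (fun i => covectorWedgeDual P 𝔥 vol i.1 i.2.1 i.2.2)
    (fun i => smoothForm_covectorWedgeDual 𝔥 vol i.1 i.2.1 i.2.2) q (X q) hX
    (poincareCartan P 𝔥 vol) fun q => by
      simp only [poincareCartan, Fintype.sum_prod_type, m, curvatureWedgeDual_eq_formPullback,
        Finset.smul_sum, smul_smul]
  rw [eulerLagrange, formInterior_apply]
  refine key.trans (Finset.sum_congr rfl fun i _ => ?_)
  have h1 : ∀ ξ : Multiplier, fderiv ℝ (m i) q.2 ξ
      = (1 / 2 : ℝ) * multiplierComponent i.1 i.2.1 i.2.2 ξ :=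
    fun ξ => DFunLike.congr_fun (hm i q.2).fderiv ξ
  exact congrArg₂ (· • ·) (h1 _)
    (congrFun (curvatureWedgeDual_eq_formPullback 𝔥 vol i.1 i.2.1 i.2.2) q).symm

theorem multiplierField_eq (A B C : Poincare.Idx) (hBC : ¬ (IsMinkIdx B ∧ IsMinkIdx C))
    (q : ConfigBundle P) :
    multiplierField P A B C hBC q = ((0 : E10 × (E10 →L[ℝ] Poincare)), multiplierUnit A B C hBC) := by
  rw [multiplierField, mfderiv_prod_right]
  rfl

theorem mfderiv_fst_multiplierField (A B C : Poincare.Idx) (hBC : ¬ (IsMinkIdx B ∧ IsMinkIdx C))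
    (q : ConfigBundle P) :
    mfderiv configModel covectorModel Prod.fst q (multiplierField P A B C hBC q) = 0 := by
  rw [mfderiv_fst, multiplierField_eq]
  rfl

theorem mfderiv_snd_multiplierField (A B C : Poincare.Idx) (hBC : ¬ (IsMinkIdx B ∧ IsMinkIdx C))
    (q : ConfigBundle P) :
    mfderiv configModel 𝓘(ℝ, Multiplier) Prod.snd q (multiplierField P A B C hBC q)
      = multiplierUnit A B C hBC := by
  rw [mfderiv_snd, multiplierField_eq]
  rfl

theorem isMultiplierVariation_multiplierField (A B C : Poincare.Idx)
    (hBC : ¬ (IsMinkIdx B ∧ IsMinkIdx C)) :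
    IsMultiplierVariation P (multiplierField P A B C hBC) := by
  refine ⟨ContMDiff.contMDiffOn ?_, fun q _ => mfderiv_fst_multiplierField A B C hBC q⟩
  have h1 : ContMDiff configModel covectorModel.tangent ∞ (fun q : ConfigBundle P =>
      (⟨q.1, 0⟩ : TangentBundle covectorModel (CovectorBundle P))) :=
    (Bundle.contMDiff_zeroSection ℝ (TangentSpace (M := CovectorBundle P) covectorModel)).comp
      contMDiff_configBundle_fst
  have h2 : ContMDiff configModel 𝓘(ℝ, Multiplier).tangent ∞ (fun q : ConfigBundle P =>
      (⟨q.2, multiplierUnit A B C hBC⟩ : TangentBundle 𝓘(ℝ, Multiplier) Multiplier)) :=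
    (contMDiff_vectorSpace_iff_contDiff (V := fun _ => multiplierUnit A B C hBC).2
      contDiff_const).comp contMDiff_snd
  -- The coordinate field is the zero section of the first factor paired with a constant field on
  -- the second.
  have h3 := (contMDiff_equivTangentBundleProd_symm (I := covectorModel) (M := CovectorBundle P)
    (I' := 𝓘(ℝ, Multiplier)) (M' := Multiplier) (n := ∞)).comp (h1.prodMk h2)
  convert h3 using 1
  funext q
  rw [multiplierField_eq]
  rfl

theorem curvatureWedgeDual_swap (𝔥 : Module.Basis (Fin 6) ℝ Lorentz)
    (vol : Poincare [⋀^Fin 10]→L[ℝ] ℝ) (A B C : Poincare.Idx) (q : ConfigBundle P) :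
    curvatureWedgeDual P 𝔥 vol A C B q = - curvatureWedgeDual P 𝔥 vol A B C q := by
  have h : dualEightForm 𝔥 vol C B = - dualEightForm 𝔥 vol B C := by
    refine ContinuousAlternatingMap.ext fun v => ?_
    have h1 := vol.toAlternatingMap.map_swap (Matrix.vecCons (Poincare.basis 𝔥 B)
      (Matrix.vecCons (Poincare.basis 𝔥 C) v)) (i := 0) (j := 1) (by decide)
    refine Eq.trans ?_ h1
    refine congrArg vol (funext fun i => ?_)
    refine Fin.cases rfl (fun i => ?_) i
    refine Fin.cases rfl (fun i => ?_) i
    have hi : Equiv.swap (0 : Fin 10) 1 i.succ.succ = i.succ.succ :=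
      Equiv.swap_apply_of_ne_of_ne (Fin.succ_ne_zero _)
        (fun e => Fin.succ_ne_zero _ (Fin.succ_injective _ e))
    exact (congrArg (Matrix.vecCons (Poincare.basis 𝔥 B)
      (Matrix.vecCons (Poincare.basis 𝔥 C) v)) hi).symm
  refine ContinuousAlternatingMap.ext fun v => ?_
  rw [ContinuousAlternatingMap.neg_apply]
  simp only [curvatureWedgeDual]
  rw [wedgeProd_apply, wedgeProd_apply, h, ← Finset.sum_neg_distrib]
  refine Finset.sum_congr rfl fun σ _ => ?_
  simp only [ContinuousAlternatingMap.compContinuousLinearMap_apply,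
    ContinuousAlternatingMap.neg_apply, mul_neg, smul_neg]

/-- The factor `1/2` of `Θ` and the components `±1/2` of the unit multiplier give weights `1/4` at
`(A, B, C)` and `-1/4` at `(A, C, B)`; antisymmetry of `W` adds them up to `1/2`. For `B = C`
everything is zero. -/
theorem sum_multiplierUnit_smul {G : Type*} [AddCommGroup G] [Module ℝ G] {A B C : Poincare.Idx}
    (hBC : ¬ (IsMinkIdx B ∧ IsMinkIdx C)) (W : Poincare.Idx → Poincare.Idx → Poincare.Idx → G)
    (hW : ∀ A B C, W A C B = - W A B C) :
    ∑ i : Poincare.Idx × Poincare.Idx × Poincare.Idx,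
      ((1 / 2 : ℝ) * multiplierComponent i.1 i.2.1 i.2.2 (multiplierUnit A B C hBC))
        • W i.1 i.2.1 i.2.2 = (1 / 2 : ℝ) • W A B C := by
  have hunit : ∀ i : Poincare.Idx × Poincare.Idx × Poincare.Idx,
      (1 / 2 : ℝ) * multiplierComponent i.1 i.2.1 i.2.2 (multiplierUnit A B C hBC)
      = (if i = (A, B, C) then (1 / 4 : ℝ) else 0) - if i = (A, C, B) then (1 / 4 : ℝ) else 0 := by
    rintro ⟨A', B', C'⟩
    have h : multiplierComponent A' B' C' (multiplierUnit A B C hBC) = if A' = A then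
      ((if B' = B ∧ C' = C then 1 else 0) - (if B' = C ∧ C' = B then 1 else 0)) / 2 else 0 := rfl
    simp only [h, Prod.mk.injEq, ite_and]
    split_ifs <;> norm_num
  simp only [hunit, sub_smul, Finset.sum_sub_distrib, ite_smul, zero_smul, Finset.sum_ite_eq',
    Finset.mem_univ, if_true, hW A B C, smul_neg, sub_neg_eq_add, ← add_smul]
  norm_num

theorem eulerLagrange_multiplierField (𝔥 : Module.Basis (Fin 6) ℝ Lorentz)
    (vol : Poincare [⋀^Fin 10]→L[ℝ] ℝ) (A B C : Poincare.Idx)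
    (hBC : ¬ (IsMinkIdx B ∧ IsMinkIdx C)) (q : ConfigBundle P) :
    eulerLagrange P 𝔥 vol (multiplierField P A B C hBC) q
      = (1 / 2 : ℝ) • curvatureWedgeDual P 𝔥 vol A B C q := by
  rw [eulerLagrange_eq_sum 𝔥 vol _ q (mfderiv_fst_multiplierField A B C hBC q),
    mfderiv_snd_multiplierField]
  exact sum_multiplierUnit_smul hBC (fun A B C => curvatureWedgeDual P 𝔥 vol A B C q)
    fun A B C => curvatureWedgeDual_swap 𝔥 vol A B C q

/-- The projection to `P` factors through the covector bundle. -/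
theorem IsMultiplierVariation.isVariation {X : VField configModel (ConfigBundle P)}
    (hX : IsMultiplierVariation P X) : IsVariation P X := by
  refine ⟨hX.1, fun q hq => ?_⟩
  have h := mfderiv_comp_apply q (I := configModel) (I' := covectorModel) (I'' := 𝓡 10)
    (f := (Prod.fst : ConfigBundle P → CovectorBundle P))
    (contMDiff_covectorProj.mdifferentiable (by simp) q.1) mdifferentiableAt_fst (X q)
  refine h.trans ?_
  rw [show mfderiv configModel covectorModel Prod.fst q (X q) = 0 from hX.2 q hq]
  exact (mfderiv covectorModel (𝓡 10) (Bundle.TotalSpace.proj : CovectorBundle P → P)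
    q.1).toLinearMap.map_zero

end Variations

/-! ### Linear algebra: from admissible components to contraction with `𝔩` -/

section AlternatingMaps

variable {V V' : Type*} [AddCommGroup V] [Module ℝ V] [TopologicalSpace V]
  [AddCommGroup V'] [Module ℝ V'] [TopologicalSpace V'] {k : ℕ}

theorem compContinuousLinearMap_eq_zero_of_smul {c : ℝ} (hc : c ≠ 0) {η : V [⋀^Fin k]→L[ℝ] ℝ}
    {L : V' →L[ℝ] V} (h : (c • η).compContinuousLinearMap L = 0) :
    η.compContinuousLinearMap L = 0 := by
  have h' : c • η.compContinuousLinearMap L = 0 := h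
  exact (smul_eq_zero.1 h').resolve_left hc

theorem compContinuousLinearMap_sum_smul_eq_zero {ι : Type*} (s : Finset ι) (c : ι → ℝ)
    (W : ι → V [⋀^Fin k]→L[ℝ] ℝ) (L : V' →L[ℝ] V)
    (h : ∀ i, c i = 0 ∨ (W i).compContinuousLinearMap L = 0) :
    (∑ i ∈ s, c i • W i).compContinuousLinearMap L = 0 := by
  ext v
  simp only [ContinuousAlternatingMap.compContinuousLinearMap_apply,
    ContinuousAlternatingMap.sum_apply, ContinuousAlternatingMap.smul_apply]
  refine Finset.sum_eq_zero fun i _ => ?_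
  rcases h i with h | h
  · rw [h, zero_smul]
  · have h' : W i (L ∘ v) = 0 := congrArg (fun η : V' [⋀^Fin k]→L[ℝ] ℝ => η v) h
    rw [h', smul_zero]

theorem Poincare.basis_inr (𝔥 : Module.Basis (Fin 6) ℝ Lorentz) (i : Fin 6) :
    Poincare.basis 𝔥 (Sum.inr i) = Poincare.ofLorentz (𝔥 i) := by
  simp [Poincare.basis, Poincare.ofLorentz]
  rfl

/-- A pair whose first index lies in `𝔩` is admissible whatever the second is, so bilinearity
extends the vanishing from basis vectors to all `h` and `v`. -/
theorem apply_ofLorentz_eq_zero (𝔥 : Module.Basis (Fin 6) ℝ Lorentz) (ϖ : V ≃L[ℝ] Poincare)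
    (η : V [⋀^Fin 2]→L[ℝ] Poincare)
    (hη : ∀ A B C, ¬ (IsMinkIdx B ∧ IsMinkIdx C) → formComponent 𝔥 A η
      ![ϖ.symm (Poincare.basis 𝔥 B), ϖ.symm (Poincare.basis 𝔥 C)] = 0) (h : Lorentz) (v : V) :
    η ![ϖ.symm (Poincare.ofLorentz h), v] = 0 := by
  let T : Lorentz →ₗ[ℝ] V [⋀^Fin 1]→ₗ[ℝ] Poincare := η.toAlternatingMap.curryLeft ∘ₗ
    ϖ.symm.toLinearEquiv.toLinearMap ∘ₗ (LieAlgebra.SemiDirectSum.inr lorentzRep).toLinearMap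
  have hT : T = 0 := by
    refine 𝔥.ext fun i => ?_
    refine ((Poincare.basis 𝔥).map ϖ.symm.toLinearEquiv).ext_alternating fun w _ => ?_
    refine (Poincare.basis 𝔥).ext_elem fun A => ?_
    have h1 := hη A (Sum.inr i) (w 0) (by rintro ⟨⟨b, hb⟩, -⟩; cases hb)
    rw [Poincare.basis_inr] at h1
    refine Eq.trans ?_ (h1.trans (DFunLike.congr_fun (map_zero (Poincare.basis 𝔥).repr) A).symm)
    refine congrArg (fun x => (Poincare.basis 𝔥).repr (η x) A) (funext fun j => ?_)
    fin_cases j <;> rfl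
  exact congrArg (fun S : Lorentz →ₗ[ℝ] V [⋀^Fin 1]→ₗ[ℝ] Poincare => S h ![v]) hT

end AlternatingMaps

/-! ### The multiplier equations and their geometric consequences -/

section Main

variable {P : Type*} [TopologicalSpace P] [ChartedSpace E10 P] [IsManifold (𝓡 10) ∞ P]
  {𝔥 : Module.Basis (Fin 6) ℝ Lorentz} {vol : Poincare [⋀^Fin 10]→L[ℝ] ℝ}

theorem IsCritical.isMultiplierCritical {ϖ : Coframe P} {p : P → Multiplier}
    (h : IsCritical 𝔥 vol ϖ p) : IsMultiplierCritical 𝔥 vol ϖ p :=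
  fun X hX => h X hX.isVariation

theorem Coframe.toSection_mem_nondegenerate (ϖ : Coframe P) (p : P → Multiplier) (z : P) :
    ϖ.toSection p z ∈ nondegenerate P :=
  (ϖ.toEquiv z).bijective

/-- Coordinate fields test each admissible 10-form separately. Conversely, the Euler–Lagrange form
of any multiplier variation is a combination of these forms, the inadmissible ones having
coefficient zero. The variation is only controlled on `nondegenerate P`, which contains the image of
the section. -/
theorem isMultiplierCritical_iff_wedgeDual {ϖ : Coframe P} {p : P → Multiplier}
    (hp : ContMDiff (𝓡 10) 𝓘(ℝ, Multiplier) ∞ p) :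
    IsMultiplierCritical 𝔥 vol ϖ p ↔
      ∀ A B C, ¬ (IsMinkIdx B ∧ IsMinkIdx C) → ∀ z, ϖ.wedgeDual 𝔥 vol A B C z = 0 := by
  constructor
  · intro h A B C hBC z
    have h1 := h _ (isMultiplierVariation_multiplierField A B C hBC) z
    have h2 := congrArg (fun η => ContinuousAlternatingMap.compContinuousLinearMap η
      (mfderiv (𝓡 10) configModel (ϖ.toSection p) z))
      (eulerLagrange_multiplierField 𝔥 vol A B C hBC (ϖ.toSection p z))
    exact (ϖ.formPullback_toSection_curvatureWedgeDual hp 𝔥 vol A B C z).symm.trans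
      (compContinuousLinearMap_eq_zero_of_smul (by norm_num) (h2.symm.trans h1))
  · intro h X hX z
    have h1 := eulerLagrange_eq_sum 𝔥 vol X _ (hX.2 _ (ϖ.toSection_mem_nondegenerate p z))
    refine (congrArg (fun η => ContinuousAlternatingMap.compContinuousLinearMap η
      (mfderiv (𝓡 10) configModel (ϖ.toSection p) z)) h1).trans ?_
    refine compContinuousLinearMap_sum_smul_eq_zero _ _ _ _ fun i => ?_
    by_cases hBC : IsMinkIdx i.2.1 ∧ IsMinkIdx i.2.2
    · left
      rw [multiplierComponent_eq_zero hBC]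
      exact mul_zero _
    · right
      exact (ϖ.formPullback_toSection_curvatureWedgeDual hp 𝔥 vol i.1 i.2.1 i.2.2 z).trans
        (h _ _ _ hBC z)

theorem Coframe.wedgeDual_eq_zero_iff (hvol : vol ≠ 0) (ϖ : Coframe P) (A B C : Poincare.Idx)
    (z : P) : ϖ.wedgeDual 𝔥 vol A B C z = 0 ↔ ϖ.curvatureComponent 𝔥 A B C z = 0 :=
  wedgeProd_dualEightForm_eq_zero_iff 𝔥 hvol (ϖ.toEquiv z) _ B C

theorem Coframe.curvature_lorentzField_eq_zero {ϖ : Coframe P}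
    (hΩ : ∀ A B C, ¬ (IsMinkIdx B ∧ IsMinkIdx C) → ∀ z, ϖ.curvatureComponent 𝔥 A B C z = 0)
    (h : Lorentz) (z : P) (v : TangentSpace (𝓡 10) z) :
    ϖ.curvature z ![ϖ.lorentzField h z, v] = 0 :=
  apply_ofLorentz_eq_zero 𝔥 (ϖ.toEquiv z) (ϖ.curvature z)
    (fun A B C hBC => hΩ A B C hBC z) h v

theorem Coframe.isLorentzAction_lorentzField {ϖ : Coframe P}
    (hΩ : ∀ (h : Lorentz) (z : P) (v : TangentSpace (𝓡 10) z),
      ϖ.curvature z ![ϖ.lorentzField h z, v] = 0) : IsLorentzAction ϖ.lorentzField where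
  smooth h := ϖ.smoothFieldOn_frameField _
  map_add h k := by
    funext z
    exact (congrArg (ϖ.toEquiv z).symm (map_add (LieAlgebra.SemiDirectSum.inr lorentzRep) h k)).trans
      (map_add (ϖ.toEquiv z).symm _ _)
  map_smul c h := by
    funext z
    exact (congrArg (ϖ.toEquiv z).symm (map_smul (LieAlgebra.SemiDirectSum.inr lorentzRep) c h)).trans
      (map_smul (ϖ.toEquiv z).symm _ _)
  map_lie h k := by
    funext z
    -- Fields are compared through `ϖ`: the curvature term in the bracket formula vanishes, leaving
    -- the bracket of `𝔭`, which restricts to that of `𝔩`.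
    apply (ϖ.toEquiv z).injective
    refine (ϖ.toEquiv_frameField _ z).trans ?_
    refine Eq.trans ?_ (ϖ.toEquiv_mlieBracket_frameField _ _ z).symm
    rw [show ϖ.curvature z ![ϖ.frameField (Poincare.ofLorentz h) z,
      ϖ.frameField (Poincare.ofLorentz k) z] = 0 from hΩ h z _, sub_zero]
    exact LieHom.map_lie (LieAlgebra.SemiDirectSum.inr lorentzRep) h k

end Main

end

theorem mainTheorem2 (P : Type*) [TopologicalSpace P] [T2Space P] [SecondCountableTopology P]
    [ChartedSpace E10 P] [IsManifold (𝓡 10) ∞ P]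
    (𝔥 : Module.Basis (Fin 6) ℝ Lorentz)
    (vol : Poincare [⋀^Fin 10]→L[ℝ] ℝ) (hvol : vol ≠ 0) :
    (∀ (A B C : Poincare.Idx) (hBC : ¬ (IsMinkIdx B ∧ IsMinkIdx C)),
      IsMultiplierVariation P (multiplierField P A B C hBC) ∧
      ∀ q ∈ nondegenerate P,
        eulerLagrange P 𝔥 vol (multiplierField P A B C hBC) q
          = (1 / 2 : ℝ) • curvatureWedgeDual P 𝔥 vol A B C q) ∧
    ∀ (ϖ : Coframe P) (p : P → Multiplier), ContMDiff (𝓡 10) 𝓘(ℝ, Multiplier) ∞ p →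
      formPullback (𝓡 10) configModel (ϖ.toSection p) (universalCurvature P) = ϖ.curvature ∧
      (IsMultiplierCritical 𝔥 vol ϖ p ↔
        ∀ A B C, ¬ (IsMinkIdx B ∧ IsMinkIdx C) → ∀ z, ϖ.curvatureComponent 𝔥 A B C z = 0) ∧
      (IsMultiplierCritical 𝔥 vol ϖ p ↔
        ∀ A B C, ¬ (IsMinkIdx B ∧ IsMinkIdx C) → ∀ z, ϖ.wedgeDual 𝔥 vol A B C z = 0) ∧
      (IsMultiplierCritical 𝔥 vol ϖ p →
        ϖ.IsGeneralisedCartanConnection ∧ IsLorentzAction ϖ.lorentzField) ∧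
      (IsCritical 𝔥 vol ϖ p →
        (∀ A B C, ¬ (IsMinkIdx B ∧ IsMinkIdx C) → ∀ z, ϖ.curvatureComponent 𝔥 A B C z = 0) ∧
        ϖ.IsGeneralisedCartanConnection ∧ IsLorentzAction ϖ.lorentzField) := by
  refine ⟨fun A B C hBC => ⟨isMultiplierVariation_multiplierField A B C hBC,
    fun q _ => eulerLagrange_multiplierField 𝔥 vol A B C hBC q⟩, fun ϖ p hp => ?_⟩
  have hwedge := isMultiplierCritical_iff_wedgeDual (𝔥 := 𝔥) (vol := vol) (ϖ := ϖ) hp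
  have hcomp : IsMultiplierCritical 𝔥 vol ϖ p ↔
      ∀ A B C, ¬ (IsMinkIdx B ∧ IsMinkIdx C) → ∀ z, ϖ.curvatureComponent 𝔥 A B C z = 0 := by
    simpa only [ϖ.wedgeDual_eq_zero_iff hvol] using hwedge
  have hconn : IsMultiplierCritical 𝔥 vol ϖ p →
      ϖ.IsGeneralisedCartanConnection ∧ IsLorentzAction ϖ.lorentzField := by
    intro h
    have hΩ := Coframe.curvature_lorentzField_eq_zero (hcomp.1 h)
    exact ⟨fun h z v => (ϖ.formLieDeriv_frameField _ z v).trans (hΩ h z v),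
      Coframe.isLorentzAction_lorentzField hΩ⟩
  exact ⟨ϖ.formPullback_toSection_universalCurvature hp, hcomp, hwedge, hconn,
    fun h => ⟨hcomp.1 h.isMultiplierCritical, hconn h.isMultiplierCritical⟩⟩
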